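/- **Setting.** Let $(\mathsf M,\mathsf d)$ be a metric space, $(E,\mathcal E,\mu)$ a $\sigma$-finite measure space and $\{A_x\}_{x\in\mathsf M}\subset\mathcal E$ a family of sets with $\mu(A_x)<\infty$ and $\mathsf d(x,y)=\mu(A_x\Delta A_y)$ for all $x,y\in\mathsf M$, such that $\{(x,e):e\in A_x\}$ is measurable in $\mathsf M\times E$. Let $\lambda$ be a Borel measure on $\mathsf M$ (for instance a Radon measure). For $\delta,\delta'>0$ let $\mathcal F_{\delta,\delta',1}(\mathsf M)$ be the class of bounded Borel functions $f:\mathsf M\to\mathbb R$ with $\int|f|\,d\lambda<\infty$, $\int\mu(A_x)^\delta|f(x)|\,\lambda(dx)<\infty$ and, for some $C<\infty$, $$\iint e^{-\mathsf d(x,y)r}|f(x)f(y)|\,\lambda(dx)\lambda(dy)\le C r^{-\delta'}\quad\text{for all } r>0 .$$ For $r>0$ let $\mathbb P'_r$ be the law, on the space $\mathbb M_p(E)$ of point measures on $E$, of the Poisson point process with intensity measure $r\mu$, and put $$\Phi_f(r,m)=\int_{\mathsf M}\big(\mathbf 1\{m(A_x)\text{ is odd}\}-\mathbb P'_r(m(A_x)\text{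 is odd})\big)f(x)\,\lambda(dx).$$ **The limit.** Let $\alpha\in(0,2]$. Let $M_\alpha$ be a symmetric $\alpha$-stable random measure on $(0,\infty)\times\mathbb M_p(E)$ with control measure $\kappa(dr\,dm)=2r^{-1}\,dr\,\mathbb P'_r(dm)$, normalized by $\mathbb E e^{i\theta M_\alpha(B)}=e^{-\kappa(B)|\theta|^\alpha}$ for all $\theta\in\mathbb R$ and all measurable $B$ with $\kappa(B)<\infty$, and let $G_\alpha(f)=\int\Phi_f\,dM_\alpha$. **The aggregated model.** For each $n\ge1$ let $(X_i,q_i,N_{n,i})_{i\ge1}$ be i.i.d. triples, where $X_i$ is symmetric $\alpha$-stable with $\mathbb E e^{i\theta X_i}=e^{-|\theta|^\alpha}$, $q_i$ is uniform on $(0,1)$, given $q_i$ the point process $N_{n,i}$ is Poisson on $E$ with intensity measure $nq_i\mu$, and $X_i$ is independent of $(q_i,N_{n,i})$. For positive integers $m_n$ set $$G_{\alpha,n}(f)=\Big(\frac{2}{m_n}\Big)^{1/\alpha}\sum_{i=1}^{m_n}\frac{X_i}{q_i^{1/\alpha}}\int_{\mathsf M}\Big(\mathbf 1\{N_{n,i}(A_x)\text{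 is odd}\}-\mathbb P\big(N_{n,i}(A_x)\text{ is odd}\mid q_i\big)\Big)f(x)\,\lambda(dx).$$ **Theorem.** If $m_n/n\to\infty$, then for all $\delta,\delta'>0$ and every $f\in\mathcal F_{\delta,\delta',1}(\mathsf M)$ the stochastic integral $G_\alpha(f)$ is well defined and $$\lim_{n\to\infty}\mathbb E\exp\big(iG_{\alpha,n}(f)\big)=\mathbb E\exp\big(iG_\alpha(f)\big).$$ -/

import Mathlib

open MeasureTheory ProbabilityTheory Filter Topology
open scoped ENNReal NNReal

noncomputable section

/-! ## Point measures and Poisson point processes -/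

/-- Point measures on a measurable space: measures with values in `{0, 1, 2, …} ∪ {∞}`. It carries
the (subtype) σ-algebra generated by the evaluations `m ↦ m A`, `A` measurable. -/
abbrev PointMeasure (E : Type*) [MeasurableSpace E] : Type _ :=
  {m : Measure E // ∀ A : Set E, MeasurableSet A → ∃ k : ℕ∞, m A = (k : ℝ≥0∞)}

/-- The event `m(A) is odd`. -/
def oddEvent {E : Type*} [MeasurableSpace E] (A : Set E) : Set (PointMeasure E) :=
  {m | ∃ k : ℕ, Odd k ∧ m.1 A = (k : ℝ≥0∞)}

/-- `Q` is the law of a Poisson point process with intensity measure `ν`: the number of points in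
a set of finite intensity is Poisson distributed with mean the intensity of that set, and the
numbers of points in disjoint sets are independent. -/
structure IsPoissonLaw {E : Type*} [MeasurableSpace E] (ν : Measure E)
    (Q : Measure (PointMeasure E)) : Prop where
  isProbabilityMeasure : IsProbabilityMeasure Q
  map_count : ∀ A : Set E, MeasurableSet A → ν A < ∞ →
    Q.map (fun m => m.1 A) = (poissonMeasure (ν A).toNNReal).map (fun k : ℕ => (k : ℝ≥0∞))
  indep : ∀ (k : ℕ) (A : Fin k → Set E), (∀ i, MeasurableSet (A i)) →
    Pairwise (Function.onFun Disjoint A) →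
    iIndepFun (fun (i : Fin k) (m : PointMeasure E) => m.1 (A i)) Q

/-- `Q r` is, for every `r > 0`, the law of the Poisson point process with intensity `r • μ`.
(For `r ≤ 0` the value of the kernel is irrelevant.) -/
def IsPoissonKernel {E : Type*} [MeasurableSpace E] (μ : Measure E)
    (Q : Kernel ℝ (PointMeasure E)) : Prop :=
  ∀ r : ℝ, 0 < r → IsPoissonLaw (ENNReal.ofReal r • μ) (Q r)

/-! ## Measure definite metrics and test functions -/

/-- The metric of `M` is a measure definite kernel, represented by the sets `A x` in the measure
space `(E, μ)`: `dist x y = μ (A x ∆ A y)`. -/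
structure IsMeasureDefinite {M E : Type*} [MetricSpace M] [MeasurableSpace E]
    (μ : Measure E) (A : M → Set E) : Prop where
  measurableSet : ∀ x, MeasurableSet (A x)
  measure_lt_top : ∀ x, μ (A x) < ∞
  dist_eq : ∀ x y, dist x y = μ.real (symmDiff (A x) (A y))

/-- The class `F_{δ,δ',β}(M)` of test functions (with respect to the measure `lam` on `M`). -/
structure IsTestFunction {M E : Type*} [MetricSpace M] [MeasurableSpace M] [MeasurableSpace E]
    (μ : Measure E) (A : M → Set E) (lam : Measure M) (δ δ' β : ℝ) (f : M → ℝ) : Prop where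
  measurable : Measurable f
  bounded : ∃ C : ℝ, ∀ x, |f x| ≤ C
  lintegral_lt_top : ∫⁻ x, ENNReal.ofReal |f x| ∂lam < ∞
  lintegral_rpow_lt_top : ∫⁻ x, ENNReal.ofReal (μ.real (A x) ^ δ * |f x|) ∂lam < ∞
  lintegral_exp_le : ∃ C : ℝ, ∀ r : ℝ, 0 < r →
    ∫⁻ x, ∫⁻ y, ENNReal.ofReal (Real.exp (-(dist x y ^ β * r)) * |f x * f y|) ∂lam ∂lam
      ≤ ENNReal.ofReal (C * r ^ (-δ'))

/-- The functional
`(r, m) ↦ ∫ (1{m(A x) odd} - P'_r(m(A x) odd)) f(x) lam(dx)`,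
where `P'_r = Q r` is the law of the Poisson point process with intensity `r • μ`. -/
def oddFunctional {M E : Type*} [MeasurableSpace M] [MeasurableSpace E]
    (Q : Kernel ℝ (PointMeasure E)) (A : M → Set E) (lam : Measure M) (f : M → ℝ)
    (z : ℝ × PointMeasure E) : ℝ :=
  ∫ x, ((oddEvent (A x)).indicator (fun _ => (1 : ℝ)) z.2 - (Q z.1).real (oddEvent (A x))) * f x
    ∂lam

/-! ## Symmetric stable random measures and their stochastic integrals -/

/-- `Z` is a symmetric `α`-stable random measure with control measure `κ`, defined on the
probability space `(Ω, P)`: for sets of finite `κ`-measure, `Z B` is symmetric `α`-stable with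
characteristic function `exp (-κ(B) |θ|^α)`, the values on disjoint sets are independent, and `Z`
is almost surely σ-additive. -/
structure IsStableRandomMeasure {S Ω : Type*} [MeasurableSpace S] [MeasurableSpace Ω] (α : ℝ)
    (κ : Measure S) (P : Measure Ω) (Z : Set S → Ω → ℝ) : Prop where
  measurable : ∀ B, MeasurableSet B → κ B < ∞ → Measurable (Z B)
  charFun_eq : ∀ B, MeasurableSet B → κ B < ∞ → ∀ θ : ℝ,
    charFun (P.map (Z B)) θ = Complex.exp (((-(κ.real B * |θ| ^ α) : ℝ) : ℂ))
  indep : ∀ (k : ℕ) (B : Fin k → Set S), (∀ i, MeasurableSet (B i)) → (∀ i, κ (B i) < ∞) →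
    Pairwise (Function.onFun Disjoint B) → iIndepFun (fun i => Z (B i)) P
  sigma_additive : ∀ B : ℕ → Set S, (∀ j, MeasurableSet (B j)) →
    Pairwise (Function.onFun Disjoint B) → κ (⋃ j, B j) < ∞ →
    ∀ᵐ ω ∂P, Tendsto (fun k => ∑ j ∈ Finset.range k, Z (B j) ω) atTop (𝓝 (Z (⋃ j, B j) ω))

/-- The stochastic integral `∑ y, y * Z {s = y}` of a simple function `s`. (The term `y = 0`
vanishes.) -/
def simpleStochasticIntegral {S Ω : Type*} [MeasurableSpace S] (Z : Set S → Ω → ℝ)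
    (s : SimpleFunc S ℝ) (ω : Ω) : ℝ :=
  ∑ y ∈ s.range, y * Z (s ⁻¹' {y}) ω

/-- The random variable `Y` is (a version of) the stochastic integral `∫ F dZ` of
`F ∈ L^α(S, κ)`: there are simple functions `s k`, supported on sets of finite measure, with
`∫ |F - s k|^α dκ → 0` and `∫ s k dZ → Y` in probability. -/
def IsStochasticIntegral {S Ω : Type*} [MeasurableSpace S] [MeasurableSpace Ω] (α : ℝ)
    (κ : Measure S) (P : Measure Ω) (Z : Set S → Ω → ℝ) (F : S → ℝ) (Y : Ω → ℝ) : Prop :=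
  ∃ s : ℕ → SimpleFunc S ℝ, (∀ k, (s k).FinMeasSupp κ) ∧
    Tendsto (fun k => ∫⁻ z, ENNReal.ofReal (|F z - s k z| ^ α) ∂κ) atTop (𝓝 0) ∧
    TendstoInMeasure P (fun k => simpleStochasticIntegral Z (s k)) atTop Y

/-- The control measure `2 r⁻¹ dr dP'_r(m)` on `(0, ∞) × PointMeasure E`. -/
def controlMeasure {E : Type*} [MeasurableSpace E] (Q : Kernel ℝ (PointMeasure E)) :
    Measure (ℝ × PointMeasure E) :=
  ((volume.restrict (Set.Ioi (0 : ℝ))).withDensity (fun r => ENNReal.ofReal (2 / r))) ⊗ₘ Q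

/-! ## The aggregated model -/

/-- The random elements of the aggregated model. `X i` is symmetric `α`-stable with characteristic
function `exp (-|θ|^α)`; `q i` is uniform on `(0, 1)` and, given `q i`, the point process `N n i` is
Poisson with intensity `n * q i • μ`, that is, its conditional law is `Q (n * q i)`; `X i` is
independent of `(q i, N n i)`; and the triples `(X i, q i, N n i)`, `i = 0, 1, …`, are i.i.d. (their
common law is prescribed by the first conditions). -/
structure IsAggregatedModel {E Ω : Type*} [MeasurableSpace E] [MeasurableSpace Ω] (α : ℝ)
    (Q : Kernel ℝ (PointMeasure E)) (P : Measure Ω) (X q : ℕ → Ω → ℝ)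
    (N : ℕ → ℕ → Ω → PointMeasure E) : Prop where
  measurable_X : ∀ i, Measurable (X i)
  measurable_q : ∀ i, Measurable (q i)
  measurable_N : ∀ n, 1 ≤ n → ∀ i, Measurable (N n i)
  charFun_X : ∀ (i : ℕ) (θ : ℝ),
    charFun (P.map (X i)) θ = Complex.exp (((-(|θ| ^ α) : ℝ) : ℂ))
  map_q_N : ∀ n : ℕ, 1 ≤ n → ∀ i, P.map (fun ω => (q i ω, N n i ω)) =
    (volume.restrict (Set.Ioo (0 : ℝ) 1)) ⊗ₘ
      (Q.comap (fun r : ℝ => (n : ℝ) * r) (measurable_const_mul (n : ℝ)))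
  indep_X : ∀ n : ℕ, 1 ≤ n → ∀ i, IndepFun (X i) (fun ω => (q i ω, N n i ω)) P
  iIndep : ∀ n : ℕ, 1 ≤ n → iIndepFun (fun i ω => (X i ω, q i ω, N n i ω)) P

/-- The normalized aggregated sum
`(2 / k)^(1/α) ∑_{i < k} X_i / q_i^(1/α) ∫ (1{N_{n,i}(A x) odd} - P(N_{n,i}(A x) odd | q_i)) f dlam`
with `k` layers. As the conditional law of `N_{n,i}` given `q_i` is `Q (n * q_i)`, the conditional
probability is `Q (n * q_i) {m(A x) odd}`. -/
def aggregatedSum {M E Ω : Type*} [MeasurableSpace M] [MeasurableSpace E] (α : ℝ)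
    (Q : Kernel ℝ (PointMeasure E)) (A : M → Set E) (lam : Measure M) (X q : ℕ → Ω → ℝ)
    (N : ℕ → ℕ → Ω → PointMeasure E) (k n : ℕ) (f : M → ℝ) (ω : Ω) : ℝ :=
  (2 / (k : ℝ)) ^ (1 / α) * ∑ i ∈ Finset.range k,
    X i ω / q i ω ^ (1 / α) * oddFunctional Q A lam f ((n : ℝ) * q i ω, N n i ω)

end

/-! Conditionally on `(q, N)` a layer is a stable variable times a weight `w`, so its characteristic
function is the mean of `exp(-|w|^α)`. Substituting `r = n q` turns this mean into `1 - a_n`, where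
`m_n a_n` is the integral over `r < n` of `(1 - exp(-t b)) / t` against `dr P'_r(dm)`, with `t = n /
m_n` and `b = (2/r) |Φ_f|^α`. As `t → 0` the integrand tends to `b` and is dominated by `b`, so `(1
- a_n)^{m_n}` tends to `exp(-∫ |Φ_f|^α dκ)`, which is the characteristic function of `G_α(f)`
(`tendsto_lintegral_one_sub_exp`, `tendsto_one_sub_pow_exp`, `IsAggregatedModel.charFun_layer`).

What must be proved is that `∫ |Φ_f|^α dκ` is finite. Parity signs multiply, `(-1)^{m(A)}
(-1)^{m(B)} = (-1)^{m(A ∆ B)}`, so covariances of the parity indicators are differences of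
exponentials involving `dist x y`. Bounding them in two ways makes the second moment of `Φ_f(r, ·)`
at most of order `r^{-δ'}` and of order `r^{min(δ,1)}`; Jensen's inequality and the density `2/r`
then give convergence at both ends (`exists_measurable_oddFunctional`,
`lintegral_enorm_rpow_controlMeasure_lt_top`).

The stochastic integral is built from simple functions: their characteristic functions are explicit,
these control tails, and Borel–Cantelli gives almost sure convergence
(`IsStableRandomMeasure.exists_isStochasticIntegral`). -/

open MeasureTheory ProbabilityTheory Filter Topology
open scoped ENNReal NNReal

noncomputable section

/-! ### Parity of Poisson counts -/

section PoissonParity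

variable {E : Type*} [MeasurableSpace E]

lemma measurable_pointMeasure_apply {A : Set E} (hA : MeasurableSet A) :
    Measurable (fun m : PointMeasure E => m.1 A) :=
  (Measure.measurable_coe hA).comp measurable_subtype_coe

lemma measurableSet_odd_ennreal :
    MeasurableSet {a : ℝ≥0∞ | ∃ k : ℕ, Odd k ∧ a = (k : ℝ≥0∞)} := by
  have : {a : ℝ≥0∞ | ∃ k : ℕ, Odd k ∧ a = (k : ℝ≥0∞)}
      = (fun k : ℕ => (k : ℝ≥0∞)) '' {k | Odd k} := by
    ext a; simp [eq_comm]
  rw [this]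
  exact ((Set.to_countable _).image _).measurableSet

lemma measurableSet_oddEvent {A : Set E} (hA : MeasurableSet A) :
    MeasurableSet (oddEvent A) :=
  measurable_pointMeasure_apply hA measurableSet_odd_ennreal

/-- The generating function at `-1` gives `E[(-1)^k] = exp(-2r)`, and the indicator of odd `k` is
`(1 - (-1)^k) / 2`. -/
lemma poissonMeasure_real_odd (r : ℝ≥0) :
    (poissonMeasure r).real {k | Odd k} = (1 - Real.exp (-(2 * r))) / 2 := by
  have h1 : ∫ k, ((-1 : ℝ)) ^ k ∂(poissonMeasure r) = Real.exp (-(2 * r)) := by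
    rw [integral_poissonMeasure]
    have h := (NormedSpace.expSeries_div_hasSum_exp (-(r : ℝ))).mul_left (Real.exp (-r))
    rw [← Real.exp_eq_exp_ℝ, ← Real.exp_add] at h
    rw [show -(2 * (r : ℝ)) = -r + -r by ring, ← h.tsum_eq]
    refine tsum_congr fun n => ?_
    rw [smul_eq_mul, neg_pow (r : ℝ) n]
    ring
  have h2 : Integrable (fun k : ℕ => (-1 : ℝ) ^ k) (poissonMeasure r) :=
    Integrable.of_bound (C := 1) Measurable.of_discrete.aestronglyMeasurable
      (ae_of_all _ fun k => by simp)
  rw [← integral_indicator_one (MeasurableSet.of_discrete), ← h1]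
  have h3 : ∀ k : ℕ, ({k : ℕ | Odd k}.indicator 1 k : ℝ) = (1 - (-1) ^ k) / 2 := by
    intro k
    rcases Nat.even_or_odd k with hk | hk
    · simp [hk, Set.indicator]
    · simp [hk, Set.indicator]
  simp_rw [h3]
  rw [integral_div, integral_sub (integrable_const _) h2]
  simp

/-- The sign `(-1) ^ m(A)`, with value `1` where `m(A)` is infinite. -/
def oddSign (A : Set E) (m : PointMeasure E) : ℝ :=
  1 - 2 * (oddEvent A).indicator (fun _ => (1 : ℝ)) m

lemma measurable_oddSign {A : Set E} (hA : MeasurableSet A) : Measurable (oddSign A) :=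
  measurable_const.sub (measurable_const.mul
    (measurable_const.indicator (measurableSet_oddEvent hA)))

lemma abs_oddSign_le (A : Set E) (m : PointMeasure E) : |oddSign A m| ≤ 1 := by
  unfold oddSign
  by_cases h : m ∈ oddEvent A <;> simp [h]
  norm_num

lemma oddSign_eq_pow {A : Set E} {m : PointMeasure E} {k : ℕ} (h : m.1 A = k) :
    oddSign A m = (-1) ^ k := by
  unfold oddSign
  by_cases hk : Odd k
  · have : m ∈ oddEvent A := ⟨k, hk, h⟩
    simp [this, hk]; norm_num
  · have : m ∉ oddEvent A := by
      rintro ⟨j, hj, hj'⟩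
      rw [h] at hj'
      exact hk (by rwa [Nat.cast_injective hj'])
    rw [Nat.not_odd_iff_even] at hk
    simp [this, hk]

lemma PointMeasure.exists_nat {m : PointMeasure E} {A : Set E} (hA : MeasurableSet A)
    (h : m.1 A < ∞) : ∃ k : ℕ, m.1 A = k := by
  obtain ⟨k, hk⟩ := m.2 A hA
  rw [hk] at h ⊢
  cases k with
  | top => simp at h
  | coe k => exact ⟨k, by simp⟩

/-- Points of `A ∩ B` are counted twice and drop out modulo 2. Finiteness matters because an
infinite count has sign `1` by convention. -/
lemma oddSign_mul {A B : Set E} (hA : MeasurableSet A) (hB : MeasurableSet B)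
    {m : PointMeasure E} (h1 : m.1 A < ∞) (h2 : m.1 B < ∞) :
    oddSign A m * oddSign B m = oddSign (symmDiff A B) m := by
  obtain ⟨a, ha⟩ := PointMeasure.exists_nat (hA.diff hB)
    ((measure_mono Set.sdiff_subset).trans_lt h1)
  obtain ⟨b, hb⟩ := PointMeasure.exists_nat (hB.diff hA)
    ((measure_mono Set.sdiff_subset).trans_lt h2)
  obtain ⟨c, hc⟩ := PointMeasure.exists_nat (hA.inter hB)
    ((measure_mono Set.inter_subset_left).trans_lt h1)
  have e1 : m.1 A = ((a + c : ℕ) : ℝ≥0∞) := by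
    rw [← measure_inter_add_sdiff A hB, ha, hc]; push_cast; ring
  have e2 : m.1 B = ((b + c : ℕ) : ℝ≥0∞) := by
    rw [← measure_inter_add_sdiff B hA, hb, Set.inter_comm, hc]; push_cast; ring
  have e3 : m.1 (symmDiff A B) = ((a + b : ℕ) : ℝ≥0∞) := by
    rw [Set.symmDiff_def, measure_union disjoint_sdiff_sdiff (hB.diff hA), ha, hb]
    push_cast; rfl
  rw [oddSign_eq_pow e1, oddSign_eq_pow e2, oddSign_eq_pow e3, pow_add, pow_add, pow_add,
    mul_mul_mul_comm, ← mul_pow (-1 : ℝ) (-1) c]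
  simp

namespace IsPoissonLaw

variable {ν : Measure E} {Q : Measure (PointMeasure E)}

lemma measureReal_oddEvent (hQ : IsPoissonLaw ν Q) {A : Set E} (hA : MeasurableSet A)
    (hν : ν A < ∞) : Q.real (oddEvent A) = (1 - Real.exp (-(2 * ν.real A))) / 2 := by
  have h := congrArg (fun ξ => ξ.real {a : ℝ≥0∞ | ∃ k : ℕ, Odd k ∧ a = (k : ℝ≥0∞)})
    (hQ.map_count A hA hν)
  rw [map_measureReal_apply (measurable_pointMeasure_apply hA) measurableSet_odd_ennreal,
    map_measureReal_apply (by fun_prop) measurableSet_odd_ennreal] at h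
  have e : (fun k : ℕ => (k : ℝ≥0∞)) ⁻¹' {a : ℝ≥0∞ | ∃ k : ℕ, Odd k ∧ a = (k : ℝ≥0∞)}
      = {k | Odd k} := by
    ext k
    simp
  rw [e, poissonMeasure_real_odd] at h
  exact h

lemma ae_lt_top (hQ : IsPoissonLaw ν Q) {A : Set E} (hA : MeasurableSet A)
    (hν : ν A < ∞) : ∀ᵐ m ∂Q, m.1 A < ∞ := by
  have h : ∀ᵐ a ∂(Q.map (fun m => m.1 A)), a < ∞ := by
    rw [hQ.map_count A hA hν, ae_map_iff (by fun_prop) measurableSet_Iio]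
    exact ae_of_all _ fun k => by simp
  exact ae_of_ae_map (measurable_pointMeasure_apply hA).aemeasurable h

lemma integral_oddSign (hQ : IsPoissonLaw ν Q) {A : Set E} (hA : MeasurableSet A)
    (hν : ν A < ∞) : ∫ m, oddSign A m ∂Q = Real.exp (-(2 * ν.real A)) := by
  have := hQ.isProbabilityMeasure
  unfold oddSign
  rw [integral_sub (integrable_const _) (((integrable_const _).indicator
    (measurableSet_oddEvent hA)).const_mul _), integral_const_mul,
    integral_indicator_const _ (measurableSet_oddEvent hA), hQ.measureReal_oddEvent hA hν]
  simp
  ring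

lemma integral_oddSign_mul (hQ : IsPoissonLaw ν Q) {A B : Set E} (hA : MeasurableSet A)
    (hB : MeasurableSet B) (hνA : ν A < ∞) (hνB : ν B < ∞) :
    ∫ m, oddSign A m * oddSign B m ∂Q = Real.exp (-(2 * ν.real (symmDiff A B))) := by
  rw [← hQ.integral_oddSign (hA.symmDiff hB)
    ((measure_mono Set.symmDiff_subset_union).trans_lt (measure_union_lt_top hνA hνB))]
  refine integral_congr_ae ?_
  filter_upwards [hQ.ae_lt_top hA hνA, hQ.ae_lt_top hB hνB] with m h1 h2
  exact oddSign_mul hA hB h1 h2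

end IsPoissonLaw

/-- The point measure `m`, restricted to `S` if `m(S)` is finite, and `0` otherwise. -/
def finiteRestrictKernel {S : Set E} (hS : MeasurableSet S) : Kernel (PointMeasure E) E where
  toFun m := if m.1 S < ∞ then m.1.restrict S else 0
  measurable' := by
    refine Measurable.ite ?_ ?_ measurable_const
    · exact measurable_pointMeasure_apply hS measurableSet_Iio
    · refine Measure.measurable_of_measurable_coe _ fun B hB => ?_
      simp_rw [Measure.restrict_apply hB]
      exact measurable_pointMeasure_apply (hB.inter hS)

/-- A jointly measurable version of the indicator of `{m(A x) odd}`. -/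
lemma exists_measurable_oddEvent_indicator {M : Type*} [MeasurableSpace M]
    (μ : Measure E) [SigmaFinite μ] {A : M → Set E}
    (hAmeas : MeasurableSet {p : M × E | p.2 ∈ A p.1}) :
    ∃ g : M × PointMeasure E → ℝ, Measurable g ∧ (∀ z, |g z| ≤ 1) ∧
      ∃ S : Set (PointMeasure E), MeasurableSet S ∧
        (∀ (r : ℝ) (Q : Measure (PointMeasure E)), IsPoissonLaw (ENNReal.ofReal r • μ) Q →
          ∀ᵐ m ∂Q, m ∈ S) ∧
        ∀ m ∈ S, ∀ x, g (x, m) = (oddEvent (A x)).indicator (fun _ => (1 : ℝ)) m := by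
  have hsp := measurableSet_spanningSets μ
  -- A point measure need not be σ-finite, so measurability of sections is obtained from finite
  -- truncations. Their supremum `n` is the count of `A x` on the set of `m` that are finite on
  -- every spanning set; that set has full measure for all `r` at once.
  let K : ℕ → Kernel (M × PointMeasure E) E := fun k =>
    (finiteRestrictKernel (hsp k)).comap Prod.snd measurable_snd
  have hK : ∀ k z, IsFiniteMeasure (K k z) := by
    intro k z
    simp only [K, Kernel.comap_apply, finiteRestrictKernel, Kernel.coe_mk]
    split_ifs with h
    · exact ⟨by simpa using h⟩
    · infer_instance
  let t : Set ((M × PointMeasure E) × E) := {p | p.2 ∈ A p.1.1}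
  have ht : MeasurableSet t :=
    hAmeas.preimage (f := fun p : (M × PointMeasure E) × E => (p.1.1, p.2)) (by fun_prop)
  let n : M × PointMeasure E → ℝ≥0∞ := fun z => ⨆ k, K k z (Prod.mk z ⁻¹' t)
  have hn : Measurable n := Measurable.iSup fun k =>
    Kernel.measurable_kernel_prodMk_left_of_finite ht (hK k)
  refine ⟨(n ⁻¹' {a : ℝ≥0∞ | ∃ k : ℕ, Odd k ∧ a = (k : ℝ≥0∞)}).indicator (fun _ => (1 : ℝ)),
    measurable_const.indicator (hn measurableSet_odd_ennreal), fun z => ?_,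
    {m | ∀ k, m.1 (spanningSets μ k) < ∞}, ?_, ?_, ?_⟩
  · unfold Set.indicator; split_ifs <;> simp
  · rw [Set.ofPred_forall]
    exact MeasurableSet.iInter fun k => measurable_pointMeasure_apply (hsp k) measurableSet_Iio
  · intro r Q hQ
    simp only [Set.mem_ofPred_eq]
    rw [ae_all_iff]
    intro k
    refine hQ.ae_lt_top (hsp k) ?_
    simpa using ENNReal.mul_lt_top ENNReal.ofReal_lt_top (measure_spanningSets_lt_top μ k)
  · intro m hm x
    have hnx : n (x, m) = m.1 (A x) := by
      have hAx : MeasurableSet (A x) := measurable_prodMk_left hAmeas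
      have e : ∀ k, K k (x, m) (Prod.mk (x, m) ⁻¹' t) = m.1 (A x ∩ spanningSets μ k) := by
        intro k
        have hk : m.1 (spanningSets μ k) < ∞ := hm k
        simp only [K, Kernel.comap_apply, finiteRestrictKernel, Kernel.coe_mk, hk, if_true, t,
          Set.preimage_ofPred_eq, Set.ofPred_mem_eq]
        rw [Measure.restrict_apply hAx]
      simp only [n, e]
      rw [← Monotone.measure_iUnion, ← Set.inter_iUnion, iUnion_spanningSets, Set.inter_univ]
      exact fun i j hij => Set.inter_subset_inter_right _ (monotone_spanningSets μ hij)
    have hiff : (x, m) ∈ n ⁻¹' {a : ℝ≥0∞ | ∃ k : ℕ, Odd k ∧ a = (k : ℝ≥0∞)} ↔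
        m ∈ oddEvent (A x) := by
      rw [Set.mem_preimage, hnx]; rfl
    by_cases h : m ∈ oddEvent (A x)
    · rw [Set.indicator_of_mem (hiff.2 h), Set.indicator_of_mem h]
    · rw [Set.indicator_of_notMem (mt hiff.1 h), Set.indicator_of_notMem h]

end PoissonParity

/-! ### Second moments and covariances -/

section SecondMoment

/-- The square is a double integral over `ρ × ρ`; Fubini moves the `Q`-integral inside, where it
becomes a covariance. -/
lemma lintegral_sq_integral_le {M S : Type*} [MeasurableSpace M] [MeasurableSpace S]
    (ρ : Measure M) [IsFiniteMeasure ρ] (Q : Measure S) [IsFiniteMeasure Q]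
    {c : M × S → ℝ} (hc : Measurable c) {C : ℝ} (hcC : ∀ z, |c z| ≤ C)
    {s : M → ℝ} (hs : Measurable s) (hs1 : ∀ x, |s x| ≤ 1) {B : M → M → ℝ}
    (hB : ∀ x y, |∫ m, c (x, m) * c (y, m) ∂Q| ≤ B x y) :
    ∫⁻ m, ENNReal.ofReal ((∫ x, c (x, m) * s x ∂ρ) ^ 2) ∂Q
      ≤ ∫⁻ x, ∫⁻ y, ENNReal.ofReal (B x y) ∂ρ ∂ρ := by
  have hb : ∀ x m, |c (x, m) * s x| ≤ C := fun x m => by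
    rw [abs_mul]
    exact (mul_le_of_le_one_right (abs_nonneg _) (hs1 x)).trans (hcC _)
  let h : S → M × M → ℝ := fun m z => (c (z.1, m) * s z.1) * (c (z.2, m) * s z.2)
  have hh : Measurable (Function.uncurry h) := by
    simp only [h, Function.uncurry_def]
    fun_prop
  have hhC : ∀ m z, ‖h m z‖ ≤ C * C := fun m z => by
    rw [norm_mul]
    exact mul_le_mul (hb _ _) (hb _ _) (norm_nonneg _) ((abs_nonneg _).trans (hb z.1 m))
  have e1 : ∀ m, (∫ x, c (x, m) * s x ∂ρ) ^ 2 = ∫ z, h m z ∂(ρ.prod ρ) := fun m => by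
    rw [sq, ← integral_prod_mul]
  have hint : Integrable (Function.uncurry h) (Q.prod (ρ.prod ρ)) :=
    Integrable.of_bound hh.aestronglyMeasurable (C * C) (ae_of_all _ fun p => hhC p.1 p.2)
  have e2 : ∫⁻ m, ENNReal.ofReal ((∫ x, c (x, m) * s x ∂ρ) ^ 2) ∂Q
      = ENNReal.ofReal (∫ m, ∫ z, h m z ∂(ρ.prod ρ) ∂Q) := by
    have hi : Integrable (fun m => ∫ z, h m z ∂(ρ.prod ρ)) Q := hint.integral_prod_left
    rw [ofReal_integral_eq_lintegral_ofReal hi]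
    · simp_rw [e1]
    · exact ae_of_all _ fun m => by simp only [← e1]; positivity
  rw [e2, integral_integral_swap hint]
  have hm : Measurable fun z : M × M => ∫ m, h m z ∂Q :=
    (hh.stronglyMeasurable.integral_prod_left').measurable
  calc ENNReal.ofReal (∫ z, ∫ m, h m z ∂Q ∂(ρ.prod ρ))
      ≤ ‖∫ z, ∫ m, h m z ∂Q ∂(ρ.prod ρ)‖ₑ := Real.ofReal_le_enorm _
    _ ≤ ∫⁻ z, ‖∫ m, h m z ∂Q‖ₑ ∂(ρ.prod ρ) := enorm_integral_le_lintegral_enorm _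
    _ = ∫⁻ x, ∫⁻ y, ‖∫ m, h m (x, y) ∂Q‖ₑ ∂ρ ∂ρ :=
        lintegral_prod _ hm.enorm.aemeasurable
    _ ≤ _ := by
        refine lintegral_mono fun x => lintegral_mono fun y => ?_
        rw [Real.enorm_eq_ofReal_abs]
        refine ENNReal.ofReal_le_ofReal ?_
        have e3 : ∫ m, h m (x, y) ∂Q = (s x * s y) * ∫ m, c (x, m) * c (y, m) ∂Q := by
          rw [← integral_const_mul]
          congr 1; ext m; simp only [h]; ring
        rw [e3, abs_mul, abs_mul]
        exact (mul_le_of_le_one_left (abs_nonneg _)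
          (mul_le_one₀ (hs1 x) (abs_nonneg _) (hs1 y))).trans (hB x y)

/-- The probability that a Poisson variable of mean `r * a` is odd. -/
def oddProb (r a : ℝ) : ℝ := (1 - Real.exp (-(2 * (r * a)))) / 2

lemma abs_oddProb_le {r a : ℝ} (h : 0 ≤ r * a) : |oddProb r a| ≤ 1 := by
  have h1 : Real.exp (-(2 * (r * a))) ≤ 1 := Real.exp_le_one_iff.2 (by linarith)
  have h2 := Real.exp_pos (-(2 * (r * a)))
  unfold oddProb
  rw [abs_le]; constructor <;> linarith

section Covariance

variable {M E : Type*} [MetricSpace M] [MeasurableSpace E] {μ : Measure E} {A : M → Set E}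
  {Q : Measure (PointMeasure E)} {r : ℝ}

lemma ofReal_smul_real (hr : 0 < r) (B : Set E) :
    (ENNReal.ofReal r • μ).real B = r * μ.real B := by
  simp [measureReal_def, ENNReal.toReal_mul, hr.le]

lemma IsMeasureDefinite.smul_lt_top (hA : IsMeasureDefinite μ A) (x : M) :
    (ENNReal.ofReal r • μ) (A x) < ∞ := by
  simpa using ENNReal.mul_lt_top ENNReal.ofReal_lt_top (hA.measure_lt_top x)

lemma IsMeasureDefinite.measureReal_oddEvent (hA : IsMeasureDefinite μ A) (hr : 0 < r)
    (hQ : IsPoissonLaw (ENNReal.ofReal r • μ) Q) (x : M) :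
    Q.real (oddEvent (A x)) = oddProb r (μ.real (A x)) := by
  rw [hQ.measureReal_oddEvent (hA.measurableSet x) (hA.smul_lt_top x), ofReal_smul_real hr,
    oddProb]

/-- A centred indicator is `-1/2` times the centred sign, so this is a quarter of the covariance of
the signs. The distance enters as the measure of `A x ∆ A y`. -/
lemma IsMeasureDefinite.integral_centered_mul (hA : IsMeasureDefinite μ A) (hr : 0 < r)
    (hQ : IsPoissonLaw (ENNReal.ofReal r • μ) Q) (x y : M) :
    ∫ m, ((oddEvent (A x)).indicator (fun _ => (1 : ℝ)) m - oddProb r (μ.real (A x))) *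
      ((oddEvent (A y)).indicator (fun _ => (1 : ℝ)) m - oddProb r (μ.real (A y))) ∂Q
      = (Real.exp (-(2 * (r * dist x y))) -
        Real.exp (-(2 * (r * (μ.real (A x) + μ.real (A y)))))) / 4 := by
  have := hQ.isProbabilityMeasure
  have hx := hA.measurableSet x
  have hy := hA.measurableSet y
  have hi : ∀ z, Integrable (oddSign (A z)) Q := fun z =>
    Integrable.of_bound (measurable_oddSign (hA.measurableSet z)).aestronglyMeasurable 1
      (ae_of_all _ (abs_oddSign_le _))
  have hixy : Integrable (fun m => oddSign (A x) m * oddSign (A y) m) Q :=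
    (hi x).bdd_mul (c := 1) (measurable_oddSign hy).aestronglyMeasurable
      (ae_of_all _ (abs_oddSign_le _)) |>.congr (ae_of_all _ fun m => mul_comm _ _)
  set p := Real.exp (-(2 * (r * μ.real (A x)))) with hp
  set q := Real.exp (-(2 * (r * μ.real (A y)))) with hq
  have e : ∀ m, ((oddEvent (A x)).indicator (fun _ => (1 : ℝ)) m - oddProb r (μ.real (A x))) *
      ((oddEvent (A y)).indicator (fun _ => (1 : ℝ)) m - oddProb r (μ.real (A y)))
      = (oddSign (A x) m * oddSign (A y) m - oddSign (A x) m * q - oddSign (A y) m * p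
        + p * q) / 4 := by
    intro m
    simp only [oddSign, oddProb, ← hp, ← hq]
    ring
  simp_rw [e]
  have i1 : Integrable (fun m => oddSign (A x) m * oddSign (A y) m - oddSign (A x) m * q) Q :=
    hixy.sub ((hi x).mul_const q)
  have i2 : Integrable (fun m => oddSign (A x) m * oddSign (A y) m - oddSign (A x) m * q
      - oddSign (A y) m * p) Q := i1.sub ((hi y).mul_const p)
  rw [integral_div, integral_add i2 (integrable_const _), integral_sub i1 ((hi y).mul_const p),
    integral_sub hixy ((hi x).mul_const q), integral_mul_const, integral_mul_const,
    hQ.integral_oddSign_mul hx hy (hA.smul_lt_top x) (hA.smul_lt_top y),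
    hQ.integral_oddSign hx (hA.smul_lt_top x), hQ.integral_oddSign hy (hA.smul_lt_top y),
    ofReal_smul_real hr, ofReal_smul_real hr, ofReal_smul_real hr, ← hA.dist_eq, ← hp, ← hq]
  have : Real.exp (-(2 * (r * (μ.real (A x) + μ.real (A y))))) = p * q := by
    rw [hp, hq, ← Real.exp_add]; ring_nf
  rw [this]
  simp
  ring

lemma IsMeasureDefinite.dist_le_add (hA : IsMeasureDefinite μ A) (x y : M) :
    dist x y ≤ μ.real (A x) + μ.real (A y) := by
  rw [hA.dist_eq]
  exact (measureReal_mono Set.symmDiff_subset_union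
    (measure_union_lt_top (hA.measure_lt_top x) (hA.measure_lt_top y)).ne).trans
    (measureReal_union_le _ _)

lemma IsMeasureDefinite.real_le_add_dist (hA : IsMeasureDefinite μ A) (x y : M) :
    μ.real (A y) ≤ μ.real (A x) + dist x y := by
  rw [hA.dist_eq]
  have h1 : μ (symmDiff (A x) (A y)) < ∞ := (measure_mono Set.symmDiff_subset_union).trans_lt
    (measure_union_lt_top (hA.measure_lt_top x) (hA.measure_lt_top y))
  refine (measureReal_mono (fun e he => ?_)
    (measure_union_lt_top (hA.measure_lt_top x) h1).ne).trans (measureReal_union_le _ _)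
  by_cases hx : e ∈ A x
  · exact Or.inl hx
  · exact Or.inr (Or.inr ⟨he, hx⟩)

/-- The first bound serves large `r`, the other small `r`. Since `μ(A y) ≤ μ(A x) + dist x y`, the
second exponential is at least `exp(-4 r μ(A x))` times the first, which yields a bound in terms of
`x` alone. -/
lemma IsMeasureDefinite.abs_covariance_le (hA : IsMeasureDefinite μ A) (hr : 0 < r) (x y : M) :
    |(Real.exp (-(2 * (r * dist x y))) -
        Real.exp (-(2 * (r * (μ.real (A x) + μ.real (A y)))))) / 4|
      ≤ min (Real.exp (-(dist x y * r))) (min 1 (r * μ.real (A x))) := by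
  have h1 := hA.dist_le_add x y
  have h2 := hA.real_le_add_dist x y
  have hd := dist_nonneg (x := x) (y := y)
  have ha := measureReal_nonneg (μ := μ) (s := A x)
  have hrd : 0 ≤ r * dist x y := by positivity
  have hra : 0 ≤ r * μ.real (A x) := by positivity
  set u := Real.exp (-(2 * (r * dist x y))) with hu
  set v := Real.exp (-(2 * (r * (μ.real (A x) + μ.real (A y))))) with hv
  have hvpos : 0 < v := Real.exp_pos _
  have hupos : 0 < u := Real.exp_pos _
  have hu1 : u ≤ 1 := Real.exp_le_one_iff.2 (by linarith)
  have hud : u ≤ Real.exp (-(dist x y * r)) := Real.exp_le_exp.2 (by linarith)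
  have hvu : v ≤ u := Real.exp_le_exp.2 (by
    have := mul_le_mul_of_nonneg_left h1 hr.le
    linarith)
  have hw : u * (1 - 4 * (r * μ.real (A x))) ≤ v := by
    have h3 : u * Real.exp (-(4 * (r * μ.real (A x)))) ≤ v := by
      rw [hu, hv, ← Real.exp_add]
      refine Real.exp_le_exp.2 ?_
      have := mul_le_mul_of_nonneg_left h2 hr.le
      linarith
    have h4 := Real.add_one_le_exp (-(4 * (r * μ.real (A x))))
    refine le_trans (mul_le_mul_of_nonneg_left ?_ hupos.le) h3
    linarith
  have hw2 : u * (r * μ.real (A x)) ≤ r * μ.real (A x) := mul_le_of_le_one_left hra hu1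
  rw [abs_of_nonneg (by linarith)]
  refine le_min ?_ (le_min ?_ ?_) <;> linarith

end Covariance

/-- With exponent `min δ 1`, this and `rpow_min_one_le` reduce the small-`r` bound to the
integrability of `|f|` and `μ(A x)^δ |f|`. -/
lemma min_one_le_rpow {t ε : ℝ} (ht : 0 ≤ t) (hε : 0 < ε) (hε1 : ε ≤ 1) : min 1 t ≤ t ^ ε := by
  rcases le_total 1 t with h | h
  · exact (min_le_left _ _).trans (Real.one_le_rpow h hε.le)
  · exact (min_le_right _ _).trans (Real.self_le_rpow_of_le_one ht h hε1)

lemma rpow_min_one_le {a δ : ℝ} (ha : 0 ≤ a) (hδ : 0 < δ) : a ^ min δ 1 ≤ 1 + a ^ δ := by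
  have h0 : 0 ≤ a ^ δ := Real.rpow_nonneg ha δ
  have hm : 0 < min δ 1 := lt_min hδ one_pos
  rcases le_total 1 a with h | h
  · have := Real.rpow_le_rpow_of_exponent_le h (min_le_left δ 1)
    linarith
  · have := Real.rpow_le_one ha h hm.le
    linarith

end SecondMoment

/-! ### A measurable version of the functional and its decay -/

section MeasurableVersion

variable {M E : Type*} [MeasurableSpace M] [MeasurableSpace E] {μ : Measure E} {A : M → Set E}

lemma measurable_oddProb : Measurable fun z : ℝ × ℝ => oddProb z.1 z.2 := by
  unfold oddProb
  fun_prop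

lemma measurable_measureReal_section [SigmaFinite μ]
    (hAmeas : MeasurableSet {p : M × E | p.2 ∈ A p.1}) : Measurable fun x => μ.real (A x) :=
  (measurable_measure_prodMk_left (ν := μ) hAmeas).ennreal_toReal

/-- The density is measurable and finite, so `g` may be arbitrary; iterated integrals can be
rewritten without checking measurability of the inner one. -/
lemma lintegral_withDensity_abs (lam : Measure M) {f : M → ℝ} (hf : Measurable f) (g : M → ℝ≥0∞) :
    ∫⁻ x, g x ∂(lam.withDensity fun x => ENNReal.ofReal |f x|)
      = ∫⁻ x, ENNReal.ofReal |f x| * g x ∂lam :=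
  lintegral_withDensity_eq_lintegral_mul_non_measurable _ (by fun_prop)
    (ae_of_all _ fun _ => ENNReal.ofReal_lt_top) _

lemma integral_withDensity_abs_mul_sign (lam : Measure M) {f : M → ℝ} (hf : Measurable f)
    (g : M → ℝ) :
    ∫ x, g x * (SignType.sign (f x) : ℝ) ∂(lam.withDensity fun x => ENNReal.ofReal |f x|)
      = ∫ x, g x * f x ∂lam := by
  have h := integral_withDensity_eq_integral_smul (μ := lam)
    (f := fun x => Real.toNNReal |f x|) (by fun_prop) (fun x => g x * (SignType.sign (f x) : ℝ))
  refine h.trans (integral_congr_ae (ae_of_all _ fun x => ?_))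
  simp only [NNReal.smul_def, Real.coe_toNNReal _ (abs_nonneg _), smul_eq_mul]
  rw [mul_left_comm, abs_mul_sign]

/-- The functional `oddFunctional` has a jointly measurable version; its second moment decays
polynomially both as `r → ∞` and as `r → 0`. -/
lemma exists_measurable_oddFunctional [MetricSpace M] [SigmaFinite μ] (hA : IsMeasureDefinite μ A)
    (hAmeas : MeasurableSet {p : M × E | p.2 ∈ A p.1}) (lam : Measure M)
    (Q : Kernel ℝ (PointMeasure E)) (hQ : IsPoissonKernel μ Q) {δ δ' : ℝ} (hδ : 0 < δ)
    {f : M → ℝ} (hf : IsTestFunction μ A lam δ δ' 1 f) :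
    ∃ Ψ : ℝ × PointMeasure E → ℝ, Measurable Ψ ∧
      (∃ T : Set (PointMeasure E), MeasurableSet T ∧ (∀ r : ℝ, 0 < r → ∀ᵐ m ∂(Q r), m ∈ T) ∧
        ∀ r : ℝ, 0 < r → ∀ m ∈ T, Ψ (r, m) = oddFunctional Q A lam f (r, m)) ∧
      ∃ C C' : ℝ, 0 ≤ C ∧ 0 ≤ C' ∧ ∀ r : ℝ, 0 < r →
        ∫⁻ m, ENNReal.ofReal (Ψ (r, m) ^ 2) ∂(Q r) ≤ ENNReal.ofReal (C * r ^ (-δ')) ∧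
        ∫⁻ m, ENNReal.ofReal (Ψ (r, m) ^ 2) ∂(Q r) ≤ ENNReal.ofReal (C' * r ^ min δ 1) := by
  obtain ⟨g, hg, hg1, S, hS, hQS, hgS⟩ := exists_measurable_oddEvent_indicator μ hAmeas
  have hfm := hf.measurable
  -- Absorbing `|f|` into a finite measure and keeping only the sign `s` of `f` makes every
  -- integrand bounded.
  let ρ : Measure M := lam.withDensity fun x => ENNReal.ofReal |f x|
  have hρ : IsFiniteMeasure ρ := isFiniteMeasure_withDensity hf.lintegral_lt_top.ne
  let s : M → ℝ := fun x => (SignType.sign (f x) : ℝ)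
  have hs : Measurable s := by
    have : s = fun x => if 0 < f x then 1 else if f x < 0 then -1 else 0 := by
      ext x
      simp only [s, sign_apply]
      split_ifs <;> simp
    rw [this]
    exact Measurable.ite (measurableSet_lt measurable_const hfm) measurable_const
      (Measurable.ite (measurableSet_lt hfm measurable_const) measurable_const measurable_const)
  have hs1 : ∀ x, |s x| ≤ 1 := fun x => by
    simp only [s]
    rcases lt_trichotomy (f x) 0 with h | h | h <;> simp [h]
  have ha := measurable_measureReal_section (μ := μ) hAmeas
  have hb : ∀ {r : ℝ}, 0 < r → ∀ z : M × PointMeasure E,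
      |g z - oddProb r (μ.real (A z.1))| ≤ 2 := fun hr z =>
    (abs_sub _ _).trans (by
      have := abs_oddProb_le (r := _) (a := μ.real (A z.1))
        (mul_nonneg hr.le measureReal_nonneg)
      linarith [hg1 z])
  -- The closed form `oddProb` replaces the `Q r`-probability, which makes joint measurability in
  -- `(r, x)` explicit.
  refine ⟨fun z => ∫ x, (g (x, z.2) - oddProb z.1 (μ.real (A x))) * s x ∂ρ, ?_, ?_, ?_⟩
  · have h : Measurable fun p : M × (ℝ × PointMeasure E) =>
        (g (p.1, p.2.2) - oddProb p.2.1 (μ.real (A p.1))) * s p.1 := by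
      refine Measurable.mul (Measurable.sub (by fun_prop) ?_) (by fun_prop)
      exact measurable_oddProb.comp (measurable_snd.fst.prodMk (ha.comp measurable_fst))
    exact h.stronglyMeasurable.integral_prod_left'.measurable
  · refine ⟨S, hS, fun r hr => hQS r _ (hQ r hr), fun r hr m hm => ?_⟩
    simp only [oddFunctional]
    rw [integral_withDensity_abs_mul_sign lam hfm]
    refine integral_congr_ae (ae_of_all _ fun x => ?_)
    simp only
    rw [hgS m hm x, hA.measureReal_oddEvent hr (hQ r hr) x]
  · have key : ∀ r : ℝ, 0 < r → ∫⁻ m, ENNReal.ofReal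
        ((∫ x, (g (x, m) - oddProb r (μ.real (A x))) * s x ∂ρ) ^ 2) ∂(Q r) ≤
        ∫⁻ x, ∫⁻ y, ENNReal.ofReal (min (Real.exp (-(dist x y * r)))
          (min 1 (r * μ.real (A x)))) ∂ρ ∂ρ := by
      intro r hr
      have := (hQ r hr).isProbabilityMeasure
      refine lintegral_sq_integral_le ρ (Q r)
        (c := fun z => g z - oddProb r (μ.real (A z.1))) (C := 2) ?_ (hb hr) hs hs1 fun x y => ?_
      · exact hg.sub (measurable_oddProb.comp (measurable_const.prodMk (ha.comp measurable_fst)))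
      · refine le_trans (le_of_eq ?_) (hA.abs_covariance_le hr x y)
        rw [← hA.integral_centered_mul hr (hQ r hr) x y]
        congr 1
        refine integral_congr_ae ?_
        filter_upwards [hQS r _ (hQ r hr)] with m hm
        simp only [hgS m hm]
    obtain ⟨C, hC⟩ := hf.lintegral_exp_le
    let D : ℝ≥0∞ := ∫⁻ x, ENNReal.ofReal (1 + μ.real (A x) ^ δ) ∂ρ
    have hD : D < ∞ := by
      have e : D = ρ Set.univ + ∫⁻ x, ENNReal.ofReal (μ.real (A x) ^ δ * |f x|) ∂lam := by
        simp only [D]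
        rw [lintegral_congr fun x => ENNReal.ofReal_add zero_le_one
          (Real.rpow_nonneg measureReal_nonneg δ), lintegral_add_left measurable_const]
        congr 1
        · simp
        · rw [lintegral_withDensity_abs lam hfm]
          refine lintegral_congr fun x => ?_
          rw [← ENNReal.ofReal_mul (abs_nonneg _), mul_comm]
      rw [e]
      exact ENNReal.add_lt_top.2 ⟨measure_lt_top _ _, hf.lintegral_rpow_lt_top⟩
    -- The hypothesis does not fix the sign of `C`, hence `max C 0`. The factor `ρ Set.univ` comes
    -- from integrating out `y`, on which the small-`r` bound does not depend.
    refine ⟨max C 0, (D * ρ Set.univ).toReal, le_max_right _ _, ENNReal.toReal_nonneg,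
      fun r hr => ⟨(key r hr).trans ?_, (key r hr).trans ?_⟩⟩
    · calc _ ≤ ∫⁻ x, ∫⁻ y, ENNReal.ofReal (Real.exp (-(dist x y * r))) ∂ρ ∂ρ :=
            lintegral_mono fun x => lintegral_mono fun y =>
              ENNReal.ofReal_le_ofReal (min_le_left _ _)
        _ = ∫⁻ x, ∫⁻ y, ENNReal.ofReal (Real.exp (-(dist x y ^ (1 : ℝ) * r)) * |f x * f y|)
              ∂lam ∂lam := by
            rw [lintegral_withDensity_abs lam hfm]
            refine lintegral_congr fun x => ?_
            rw [lintegral_withDensity_abs lam hfm, ← lintegral_const_mul' _ _ ENNReal.ofReal_ne_top]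
            refine lintegral_congr fun y => ?_
            rw [← ENNReal.ofReal_mul (abs_nonneg _), ← ENNReal.ofReal_mul (abs_nonneg _),
              Real.rpow_one, abs_mul]
            ring_nf
        _ ≤ ENNReal.ofReal (C * r ^ (-δ')) := hC r hr
        _ ≤ _ := ENNReal.ofReal_le_ofReal
            (mul_le_mul_of_nonneg_right (le_max_left _ _) (Real.rpow_nonneg hr.le _))
    · calc _ ≤ ∫⁻ x, ∫⁻ _, ENNReal.ofReal (r ^ min δ 1) *
              ENNReal.ofReal (1 + μ.real (A x) ^ δ) ∂ρ ∂ρ := by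
            refine lintegral_mono fun x => lintegral_mono fun y => ?_
            rw [← ENNReal.ofReal_mul (Real.rpow_nonneg hr.le _)]
            refine ENNReal.ofReal_le_ofReal ((min_le_right _ _).trans
              ((min_one_le_rpow (mul_nonneg hr.le measureReal_nonneg) (lt_min hδ one_pos)
                (min_le_right _ _)).trans ?_))
            rw [Real.mul_rpow hr.le measureReal_nonneg]
            exact mul_le_mul_of_nonneg_left (rpow_min_one_le measureReal_nonneg hδ)
              (Real.rpow_nonneg hr.le _)
        _ = ENNReal.ofReal ((D * ρ Set.univ).toReal * r ^ min δ 1) := by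
            simp_rw [lintegral_const]
            rw [ENNReal.ofReal_mul ENNReal.toReal_nonneg, ENNReal.ofReal_toReal
              (ENNReal.mul_lt_top hD (measure_lt_top _ _)).ne,
              lintegral_mul_const' _ _ (measure_lt_top _ _).ne,
              lintegral_const_mul' _ _ ENNReal.ofReal_ne_top]
            ring

end MeasurableVersion

/-! ### Integrability with respect to the control measure -/

section ControlMeasure

/-- Monotonicity of `L^p` norms on a probability space, from `α` to `2`. -/
lemma lintegral_enorm_rpow_le_sq {S : Type*} [MeasurableSpace S] (Q : Measure S)
    [IsProbabilityMeasure Q] {α : ℝ} (hα0 : 0 < α) (hα2 : α ≤ 2) {g : S → ℝ} (hg : Measurable g) :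
    ∫⁻ m, ‖g m‖ₑ ^ α ∂Q ≤ (∫⁻ m, ENNReal.ofReal (g m ^ 2) ∂Q) ^ (α / 2) := by
  have h := eLpNorm'_le_eLpNorm'_of_exponent_le hα0 hα2 Q hg.aestronglyMeasurable
  have h' := ENNReal.rpow_le_rpow h hα0.le
  simp only [eLpNorm', ← ENNReal.rpow_mul, one_div, inv_mul_cancel₀ hα0.ne',
    ENNReal.rpow_one] at h'
  refine h'.trans (le_of_eq ?_)
  congr 1
  · refine lintegral_congr fun m => ?_
    rw [Real.enorm_eq_ofReal_abs, ENNReal.ofReal_rpow_of_nonneg (abs_nonneg _) zero_le_two,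
      Real.rpow_two, sq_abs]
  · ring

lemma ofReal_two_div_mul_rpow {C r e a : ℝ} (hC : 0 ≤ C) (hr : 0 < r) (ha : 0 ≤ a) :
    ENNReal.ofReal (2 / r) * ENNReal.ofReal (C * r ^ e) ^ a
      = ENNReal.ofReal (2 * C ^ a * r ^ (e * a - 1)) := by
  have h0 : 0 ≤ r ^ e := Real.rpow_nonneg hr.le e
  rw [ENNReal.ofReal_rpow_of_nonneg (mul_nonneg hC h0) ha, ← ENNReal.ofReal_mul (by positivity),
    Real.mul_rpow hC h0, ← Real.rpow_mul hr.le, Real.rpow_sub_one hr.ne']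
  congr 1
  ring

variable {E : Type*} [MeasurableSpace E] {Q : Kernel ℝ (PointMeasure E)} [IsMarkovKernel Q]

lemma lintegral_controlMeasure {F : ℝ × PointMeasure E → ℝ≥0∞} (hF : Measurable F) :
    ∫⁻ z, F z ∂(controlMeasure Q)
      = ∫⁻ r in Set.Ioi (0 : ℝ), ENNReal.ofReal (2 / r) * ∫⁻ m, F (r, m) ∂(Q r) := by
  rw [controlMeasure, Measure.lintegral_compProd hF,
    lintegral_withDensity_eq_lintegral_mul _ (by fun_prop) hF.lintegral_kernel_prod_right']
  rfl

/-- After Jensen the integrand in `r` is of order `r^{εα/2 - 1}` on `(0, 1]` and `r^{-ε'α/2 - 1}` on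
`(1, ∞)`, both integrable. -/
lemma lintegral_enorm_rpow_controlMeasure_lt_top {Ψ : ℝ × PointMeasure E → ℝ} (hΨ : Measurable Ψ)
    {α : ℝ} (hα0 : 0 < α) (hα2 : α ≤ 2) {C C' ε ε' : ℝ} (hε : 0 < ε) (hε' : 0 < ε')
    (hC : 0 ≤ C) (hC' : 0 ≤ C')
    (h : ∀ r : ℝ, 0 < r →
      ∫⁻ m, ENNReal.ofReal (Ψ (r, m) ^ 2) ∂(Q r) ≤ ENNReal.ofReal (C * r ^ (-ε')) ∧
      ∫⁻ m, ENNReal.ofReal (Ψ (r, m) ^ 2) ∂(Q r) ≤ ENNReal.ofReal (C' * r ^ ε)) :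
    ∫⁻ z, ‖Ψ z‖ₑ ^ α ∂(controlMeasure Q) < ∞ := by
  rw [lintegral_controlMeasure (by fun_prop)]
  have hα : 0 ≤ α / 2 := by positivity
  have hle : ∀ r : ℝ, ENNReal.ofReal (2 / r) * ∫⁻ m, ‖Ψ (r, m)‖ₑ ^ α ∂(Q r) ≤
      ENNReal.ofReal (2 / r) * (∫⁻ m, ENNReal.ofReal (Ψ (r, m) ^ 2) ∂(Q r)) ^ (α / 2) := fun r =>
    mul_le_mul_right (lintegral_enorm_rpow_le_sq (Q r) hα0 hα2 (by fun_prop)) _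
  rw [← Set.Ioc_union_Ioi_eq_Ioi (zero_le_one : (0 : ℝ) ≤ 1)]
  refine (lintegral_union_le _ _ _).trans_lt (ENNReal.add_lt_top.2 ⟨?_, ?_⟩)
  · have hi : IntegrableOn (fun r : ℝ => 2 * C' ^ (α / 2) * r ^ (ε * (α / 2) - 1))
        (Set.Ioc 0 1) := by
      refine Integrable.const_mul ?_ _
      rw [← IntegrableOn, integrableOn_Ioc_iff_integrableOn_Ioo,
        intervalIntegral.integrableOn_Ioo_rpow_iff one_pos]
      have : 0 < ε * (α / 2) := by positivity
      linarith
    refine lt_of_le_of_lt (setLIntegral_mono' measurableSet_Ioc fun r hr => ?_)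
      hi.lintegral_lt_top
    refine (hle r).trans ?_
    rw [← ofReal_two_div_mul_rpow hC' hr.1 hα]
    exact mul_le_mul_right (ENNReal.rpow_le_rpow (h r hr.1).2 hα) _
  · have hi : IntegrableOn (fun r : ℝ => 2 * C ^ (α / 2) * r ^ (-ε' * (α / 2) - 1))
        (Set.Ioi 1) := by
      refine Integrable.const_mul ?_ _
      refine integrableOn_Ioi_rpow_of_lt ?_ one_pos
      have : 0 < ε' * (α / 2) := by positivity
      linarith
    refine lt_of_le_of_lt (setLIntegral_mono' measurableSet_Ioi fun r hr => ?_)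
      hi.lintegral_lt_top
    have hr0 : (0 : ℝ) < r := one_pos.trans hr
    refine (hle r).trans ?_
    rw [← ofReal_two_div_mul_rpow hC hr0 hα]
    exact mul_le_mul_right (ENNReal.rpow_le_rpow (h r hr0).1 hα) _

lemma ae_controlMeasure_of_forall {T : Set (PointMeasure E)} (hT : MeasurableSet T)
    (hQT : ∀ r : ℝ, 0 < r → ∀ᵐ m ∂(Q r), m ∈ T) :
    ∀ᵐ z ∂(controlMeasure Q), 0 < z.1 ∧ z.2 ∈ T := by
  have hm : MeasurableSet {z : ℝ × PointMeasure E | 0 < z.1 ∧ z.2 ∈ T} :=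
    (measurableSet_lt measurable_const measurable_fst).inter (hT.preimage measurable_snd)
  rw [controlMeasure, Measure.ae_compProd_iff hm]
  refine (withDensity_absolutelyContinuous _ _).ae_le ?_
  filter_upwards [ae_restrict_mem measurableSet_Ioi] with r hr
  filter_upwards [hQT r hr] with m hm
  exact ⟨hr, hm⟩

end ControlMeasure

/-! ### Stochastic integrals of simple functions -/

section SimpleIntegral

variable {S Ω : Type*} [MeasurableSpace S] [MeasurableSpace Ω] {α : ℝ} {κ : Measure S}
  {P : Measure Ω} {Z : Set S → Ω → ℝ}

namespace IsStableRandomMeasure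

/-- For a sequence of empty sets the partial sums `k Z(∅)` converge, so their increments `Z(∅)` tend
to `0`. -/
lemma ae_empty (hZ : IsStableRandomMeasure α κ P Z) : ∀ᵐ ω ∂P, Z ∅ ω = 0 := by
  have h := hZ.sigma_additive (fun _ => ∅) (fun _ => MeasurableSet.empty)
    (fun _ _ _ => by simp [Function.onFun]) (by simp)
  filter_upwards [h] with ω hω
  simp only [Set.iUnion_empty, Finset.sum_const, Finset.card_range, nsmul_eq_mul] at hω
  have h1 := ((tendsto_add_atTop_iff_nat 1).2 hω).sub hω
  rw [sub_self] at h1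
  refine tendsto_nhds_unique (tendsto_const_nhds.congr fun k => ?_) h1
  push_cast; ring

lemma ae_union (hZ : IsStableRandomMeasure α κ P Z) {A B : Set S} (hA : MeasurableSet A)
    (hB : MeasurableSet B) (hAB : Disjoint A B) (hκA : κ A < ∞) (hκB : κ B < ∞) :
    ∀ᵐ ω ∂P, Z (A ∪ B) ω = Z A ω + Z B ω := by
  let D : ℕ → Set S := fun j => if j = 0 then A else if j = 1 then B else ∅
  have hU : ⋃ j, D j = A ∪ B := by
    ext e
    simp only [Set.mem_iUnion, Set.mem_union]
    constructor
    · rintro ⟨j, hj⟩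
      rcases j with _ | _ | j
      · exact Or.inl (by simpa [D] using hj)
      · exact Or.inr (by simpa [D] using hj)
      · simp [D] at hj
    · rintro (h | h)
      · exact ⟨0, by simpa [D] using h⟩
      · exact ⟨1, by simpa [D] using h⟩
  have h := hZ.sigma_additive D (fun j => ?_) (fun i j hij => ?_) ?_
  · filter_upwards [h, hZ.ae_empty] with ω hω h0
    rw [hU] at hω
    refine tendsto_nhds_unique hω (tendsto_const_nhds.congr' ?_)
    filter_upwards [eventually_ge_atTop 2] with k hk
    rw [← Finset.sum_subset (Finset.range_mono hk)]
    · simp [Finset.sum_range_succ, D]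
    · intro j _ hj
      have : 1 < j := by simpa using hj
      simp [D, show j ≠ 0 by omega, show j ≠ 1 by omega, h0]
  · rcases j with _ | _ | j <;> simp [D, hA, hB]
  · rcases i with _ | _ | i <;> rcases j with _ | _ | j <;>
      simp_all [D, Function.onFun, hAB.symm]
  · rw [hU]
    exact measure_union_lt_top hκA hκB

lemma ae_biUnion_finset (hZ : IsStableRandomMeasure α κ P Z) {ι : Type*} (t : Finset ι)
    (B : ι → Set S) (hB : ∀ i, MeasurableSet (B i)) (hd : Pairwise (Function.onFun Disjoint B))
    (hκ : ∀ i ∈ t, κ (B i) < ∞) :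
    ∀ᵐ ω ∂P, Z (⋃ i ∈ t, B i) ω = ∑ i ∈ t, Z (B i) ω := by
  classical
  induction t using Finset.induction_on with
  | empty => simpa using hZ.ae_empty
  | insert a t ha ih =>
    have h1 := ih fun i hi => hκ i (Finset.mem_insert_of_mem hi)
    have h2 := hZ.ae_union (hB a) (Finset.measurableSet_biUnion t fun i _ => hB i)
      (Set.disjoint_iUnion₂_right.2 fun i hi => hd (by rintro rfl; exact ha hi))
      (hκ a (Finset.mem_insert_self a t))
      (measure_biUnion_lt_top t.finite_toSet fun i hi => hκ i (Finset.mem_insert_of_mem hi))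
    filter_upwards [h1, h2] with ω h1 h2
    rw [Finset.set_biUnion_insert, h2, h1, Finset.sum_insert ha]

/-- The integral may be computed on a partition finer than the level sets. Cells where `h` vanishes
may have infinite measure; their terms carry the factor `0`. -/
lemma ae_simpleStochasticIntegral_map (hZ : IsStableRandomMeasure α κ P Z) {γ : Type*}
    (p : SimpleFunc S γ) (h : γ → ℝ) (hκ : ∀ c, h c ≠ 0 → κ (p ⁻¹' {c}) < ∞) :
    ∀ᵐ ω ∂P, simpleStochasticIntegral Z (p.map h) ω = ∑ c ∈ p.range, h c * Z (p ⁻¹' {c}) ω := by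
  classical
  have h1 : ∀ y ∈ (p.map h).range, ∀ᵐ ω ∂P, y ≠ 0 → Z (p.map h ⁻¹' {y}) ω
      = ∑ c ∈ p.range with h c = y, Z (p ⁻¹' {c}) ω := by
    intro y _
    by_cases hy : y = 0
    · exact ae_of_all _ fun _ h => absurd hy h
    filter_upwards [hZ.ae_biUnion_finset (p.range.filter fun c => h c = y) (fun c => p ⁻¹' {c})
      (fun c => p.measurableSet_fiber c)
      (fun c d hcd => Disjoint.preimage _ (Set.disjoint_singleton.2 hcd))
      (fun c hc => hκ c (by rw [(Finset.mem_filter.1 hc).2]; exact hy))] with ω hω _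
    rw [← hω, SimpleFunc.map_preimage_singleton]
    congr 1
    ext e
    simp
  filter_upwards [(ae_ball_iff (Finset.countable_toSet _)).2 h1] with ω hω
  rw [simpleStochasticIntegral, SimpleFunc.range_map, ← Finset.sum_fiberwise_of_maps_to
    (fun c hc => Finset.mem_image_of_mem h hc) (fun c => h c * Z (p ⁻¹' {c}) ω)]
  refine Finset.sum_congr rfl fun y hy => ?_
  rw [← SimpleFunc.range_map] at hy
  rw [Finset.sum_congr rfl (g := fun c => y * Z (p ⁻¹' {c}) ω)
    (fun c hc => by rw [(Finset.mem_filter.1 hc).2]), ← Finset.mul_sum]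
  by_cases hy0 : y = 0
  · simp [hy0]
  · rw [hω y hy hy0]

/-- All three integrals are expanded on the common partition given by `s.pair t`. -/
lemma ae_simpleStochasticIntegral_sub (hZ : IsStableRandomMeasure α κ P Z) {s t : SimpleFunc S ℝ}
    (hs : s.FinMeasSupp κ) (ht : t.FinMeasSupp κ) :
    ∀ᵐ ω ∂P, simpleStochasticIntegral Z (s - t) ω
      = simpleStochasticIntegral Z s ω - simpleStochasticIntegral Z t ω := by
  have hfst : ∀ c : ℝ × ℝ, c.1 ≠ 0 → κ (s.pair t ⁻¹' {c}) < ∞ := fun c hc =>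
    (measure_mono fun e he => by
      have : (s e, t e) = c := by simpa using he
      simp [← this]).trans_lt (hs.meas_preimage_singleton_ne_zero hc)
  have hsnd : ∀ c : ℝ × ℝ, c.2 ≠ 0 → κ (s.pair t ⁻¹' {c}) < ∞ := fun c hc =>
    (measure_mono fun e he => by
      have : (s e, t e) = c := by simpa using he
      simp [← this]).trans_lt (ht.meas_preimage_singleton_ne_zero hc)
  have h1 := hZ.ae_simpleStochasticIntegral_map (s.pair t) Prod.fst hfst
  have h2 := hZ.ae_simpleStochasticIntegral_map (s.pair t) Prod.snd hsnd
  have h3 := hZ.ae_simpleStochasticIntegral_map (s.pair t) (fun c => c.1 - c.2) fun c hc => by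
    by_cases hc1 : c.1 = 0
    · exact hsnd c fun h => hc (by rw [hc1, h, sub_zero])
    · exact hfst c hc1
  rw [SimpleFunc.map_fst_pair] at h1
  rw [SimpleFunc.map_snd_pair] at h2
  have e : (s.pair t).map (fun c => c.1 - c.2) = s - t := by ext; simp
  rw [e] at h3
  filter_upwards [h1, h2, h3] with ω h1 h2 h3
  rw [h1, h2, h3, ← Finset.sum_sub_distrib]
  exact Finset.sum_congr rfl fun c _ => sub_mul _ _ _

end IsStableRandomMeasure

lemma simpleStochasticIntegral_eq_sum_ne_zero {Ω' : Type*} (Z : Set S → Ω' → ℝ) (s : SimpleFunc S ℝ) :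
    simpleStochasticIntegral Z s
      = fun ω => ∑ y ∈ s.range with y ≠ 0, y * Z (s ⁻¹' {y}) ω := by
  ext ω
  rw [simpleStochasticIntegral, Finset.sum_filter_of_ne]
  rintro y _ h rfl
  simp at h

namespace IsStableRandomMeasure

lemma measurable_simpleStochasticIntegral (hZ : IsStableRandomMeasure α κ P Z)
    {s : SimpleFunc S ℝ} (hs : s.FinMeasSupp κ) : Measurable (simpleStochasticIntegral Z s) := by
  rw [simpleStochasticIntegral_eq_sum_ne_zero]
  refine Finset.measurable_sum _ fun y hy => Measurable.const_mul (hZ.measurable _ ?_ ?_) _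
  · exact s.measurableSet_fiber y
  · exact hs.meas_preimage_singleton_ne_zero (Finset.mem_filter.1 hy).2

lemma charFun_simpleStochasticIntegral (hZ : IsStableRandomMeasure α κ P Z) (hα : 0 < α)
    {s : SimpleFunc S ℝ} (hs : s.FinMeasSupp κ) (θ : ℝ) :
    charFun (P.map (simpleStochasticIntegral Z s)) θ
      = Complex.exp (((-(|θ| ^ α * (∫⁻ z, ‖s z‖ₑ ^ α ∂κ).toReal) : ℝ) : ℂ)) := by
  classical
  -- The zero level may have infinite measure, where nothing is known about `Z`. The nonzero values
  -- are enumerated by `Fin` to match the form of the independence axiom.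
  let T := s.range.filter fun y => y ≠ 0
  let e := T.equivFin
  let y : Fin T.card → ℝ := fun i => (e.symm i : ℝ)
  have hy0 : ∀ i, y i ≠ 0 := fun i => (Finset.mem_filter.1 (e.symm i).2).2
  have hyinj : Function.Injective y := Subtype.val_injective.comp e.symm.injective
  have hκ : ∀ i, κ (s ⁻¹' {y i}) < ∞ := fun i => hs.meas_preimage_singleton_ne_zero (hy0 i)
  have hsum : ∀ {R : Type} [AddCommMonoid R] (g : ℝ → R), ∑ c ∈ T, g c = ∑ i, g (y i) := by
    intro R _ g
    rw [← Finset.sum_coe_sort T g, ← e.symm.sum_comp]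
  have hind := hZ.indep T.card (fun i => s ⁻¹' {y i}) (fun i => s.measurableSet_fiber _) hκ
    (fun i j hij => Disjoint.preimage _ (Set.disjoint_singleton.2 (hyinj.ne hij)))
  have hind' := hind.comp (fun i x => y i * x) (fun i => measurable_const_mul (y i))
  have hm : ∀ i, Measurable (Z (s ⁻¹' {y i})) := fun i =>
    hZ.measurable _ (s.measurableSet_fiber _) (hκ i)
  have e1 : simpleStochasticIntegral Z s = ∑ i, fun ω => y i * Z (s ⁻¹' {y i}) ω := by
    rw [simpleStochasticIntegral_eq_sum_ne_zero]
    ext ω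
    simp only [Finset.sum_apply]
    exact hsum fun c => c * Z (s ⁻¹' {c}) ω
  have e2 : (∫⁻ z, ‖s z‖ₑ ^ α ∂κ).toReal = ∑ i, |y i| ^ α * κ.real (s ⁻¹' {y i}) := by
    have h1 : ∫⁻ z, ‖s z‖ₑ ^ α ∂κ = ∑ c ∈ T, ‖c‖ₑ ^ α * κ (s ⁻¹' {c}) := by
      have h2 := SimpleFunc.map_lintegral (μ := κ) (fun c : ℝ => ‖c‖ₑ ^ α) s
      rw [← SimpleFunc.lintegral_eq_lintegral] at h2
      refine Eq.trans h2 (Finset.sum_filter_of_ne ?_).symm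
      rintro c _ h rfl
      simp [hα] at h
    rw [h1, hsum fun c => ‖c‖ₑ ^ α * κ (s ⁻¹' {c}), ENNReal.toReal_sum fun i _ =>
      ENNReal.mul_ne_top (by finiteness) (hκ i).ne]
    refine Finset.sum_congr rfl fun i _ => ?_
    rw [ENNReal.toReal_mul, ← ENNReal.toReal_rpow, toReal_enorm, Real.norm_eq_abs,
      measureReal_def]
  have e3 := hind'.charFun_map_sum_eq_prod fun i => (((hm i).const_mul (y i)).aemeasurable (μ := P))
  rw [e1, e3, e2, Finset.prod_apply, Finset.mul_sum, ← Finset.sum_neg_distrib, Complex.ofReal_sum, Complex.exp_sum]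
  refine Finset.prod_congr rfl fun i _ => ?_
  rw [charFun_map_mul_comp (hm i).aemeasurable,
    hZ.charFun_eq _ (s.measurableSet_fiber _) (hκ i), abs_mul,
    Real.mul_rpow (abs_nonneg _) (abs_nonneg _)]
  congr 3
  ring

end IsStableRandomMeasure

end SimpleIntegral

/-! ### Approximation in `L^α`, including `α < 1` -/

section AlphaNorm

variable {S : Type*} [MeasurableSpace S] {α : ℝ} {κ : Measure S}

/-- The functional `(∫ |g|^α dκ)^(1/max(α,1))`, which is subadditive for all `α > 0`. -/
def alphaNorm (α : ℝ) (κ : Measure S) (g : S → ℝ) : ℝ≥0∞ :=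
  (∫⁻ z, ‖g z‖ₑ ^ α ∂κ) ^ (1 / max α 1)

lemma alphaNorm_rpow (g : S → ℝ) :
    alphaNorm α κ g ^ max α 1 = ∫⁻ z, ‖g z‖ₑ ^ α ∂κ := by
  have : 0 < max α 1 := one_pos.trans_le (le_max_right _ _)
  rw [alphaNorm, ← ENNReal.rpow_mul, one_div, inv_mul_cancel₀ this.ne', ENNReal.rpow_one]

lemma alphaNorm_sub_comm (g h : S → ℝ) : alphaNorm α κ (g - h) = alphaNorm α κ (h - g) := by
  simp only [alphaNorm, Pi.sub_apply, enorm_sub_rev]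

/-- Minkowski for `α ≥ 1`; subadditivity of `t ↦ t^α` for `α ≤ 1`. -/
lemma alphaNorm_add_le (hα : 0 < α) {g h : S → ℝ} (hg : AEMeasurable g κ)
    (hh : AEMeasurable h κ) : alphaNorm α κ (g + h) ≤ alphaNorm α κ g + alphaNorm α κ h := by
  unfold alphaNorm
  rcases le_total 1 α with h1 | h1
  · rw [max_eq_left h1]
    refine le_trans (ENNReal.rpow_le_rpow (lintegral_mono fun z => ?_) (by positivity))
      (ENNReal.lintegral_Lp_add_le hg.enorm hh.enorm h1)
    exact ENNReal.rpow_le_rpow (enorm_add_le _ _) hα.le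
  · rw [max_eq_right h1, div_one, ENNReal.rpow_one, ENNReal.rpow_one, ENNReal.rpow_one,
      ← lintegral_add_left' (by fun_prop)]
    refine lintegral_mono fun z => ?_
    exact (ENNReal.rpow_le_rpow (enorm_add_le _ _) hα.le).trans
      (ENNReal.rpow_add_le_add_rpow _ _ hα.le h1)

lemma alphaNorm_ne_top (hg : ∫⁻ z, ‖g z‖ₑ ^ α ∂κ ≠ ∞) : alphaNorm α κ g ≠ ∞ :=
  (ENNReal.rpow_lt_top_of_nonneg (by positivity) hg).ne

lemma tendsto_lintegral_enorm_rpow (hα : 0 < α) {F : S → ℝ} (hF : AEMeasurable F κ)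
    (hFκ : ∫⁻ z, ‖F z‖ₑ ^ α ∂κ ≠ ∞) {s : ℕ → S → ℝ} (hs : ∀ k, AEMeasurable (s k) κ)
    (h : Tendsto (fun k => ∫⁻ z, ‖F z - s k z‖ₑ ^ α ∂κ) atTop (𝓝 0)) :
    Tendsto (fun k => ∫⁻ z, ‖s k z‖ₑ ^ α ∂κ) atTop (𝓝 (∫⁻ z, ‖F z‖ₑ ^ α ∂κ)) := by
  have hp : 0 < max α 1 := one_pos.trans_le (le_max_right _ _)
  have hd : Tendsto (fun k => alphaNorm α κ (F - s k)) atTop (𝓝 0) := by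
    have := (ENNReal.continuous_rpow_const (y := 1 / max α 1)).tendsto 0 |>.comp h
    rwa [ENNReal.zero_rpow_of_pos (by positivity)] at this
  have hN : Tendsto (fun k => alphaNorm α κ (s k)) atTop (𝓝 (alphaNorm α κ F)) := by
    have hlow := ENNReal.Tendsto.sub (tendsto_const_nhds (x := alphaNorm α κ F)) hd
      (Or.inl (alphaNorm_ne_top hFκ))
    have hup := (tendsto_const_nhds (x := alphaNorm α κ F)).add hd
    rw [tsub_zero] at hlow
    rw [add_zero] at hup
    refine tendsto_of_tendsto_of_tendsto_of_le_of_le hlow hup (fun k => ?_) fun k => ?_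
    · rw [tsub_le_iff_right]
      have := alphaNorm_add_le hα (hs k) (hF.sub (hs k))
      rwa [add_sub_cancel] at this
    · rw [alphaNorm_sub_comm]
      have := alphaNorm_add_le hα hF ((hs k).sub hF)
      rwa [add_sub_cancel] at this
  simp_rw [← alphaNorm_rpow]
  exact (ENNReal.continuous_rpow_const.tendsto _).comp hN

lemma exists_simpleFunc_alphaNorm_sub_lt (hα : 0 < α) {F : S → ℝ} (hF : AEMeasurable F κ)
    (hFκ : ∫⁻ z, ‖F z‖ₑ ^ α ∂κ < ∞) {ε : ℝ≥0∞} (hε : ε ≠ 0) :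
    ∃ s : SimpleFunc S ℝ, s.FinMeasSupp κ ∧ alphaNorm α κ (F - s) < ε := by
  have hp : 0 < max α 1 := one_pos.trans_le (le_max_right _ _)
  have hα0 : ENNReal.ofReal α ≠ 0 := by simpa using hα
  have hF' : MemLp F (ENNReal.ofReal α) κ := by
    refine ⟨hF.aestronglyMeasurable, ?_⟩
    rw [eLpNorm_eq_lintegral_rpow_enorm_toReal hα0 ENNReal.ofReal_ne_top,
      ENNReal.toReal_ofReal hα.le]
    exact ENNReal.rpow_lt_top_of_nonneg (by positivity) hFκ.ne
  have hε' : (ε ^ max α 1) ^ (1 / α) ≠ 0 := by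
    rw [← ENNReal.rpow_mul]
    intro h
    rw [ENNReal.rpow_eq_zero_iff_of_pos (by positivity)] at h
    exact hε h
  obtain ⟨s, hs, hs'⟩ := hF'.exists_simpleFunc_eLpNorm_sub_lt ENNReal.ofReal_ne_top hε'
  refine ⟨s, (SimpleFunc.memLp_iff_finMeasSupp hα0 ENNReal.ofReal_ne_top).1 hs', ?_⟩
  rw [eLpNorm_eq_lintegral_rpow_enorm_toReal hα0 ENNReal.ofReal_ne_top,
    ENNReal.toReal_ofReal hα.le, ENNReal.rpow_lt_rpow_iff (by positivity)] at hs
  rwa [← alphaNorm_rpow, ENNReal.rpow_lt_rpow_iff hp] at hs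

lemma ofReal_abs_rpow (hα : 0 < α) (x : ℝ) : ENNReal.ofReal (|x| ^ α) = ‖x‖ₑ ^ α := by
  rw [Real.enorm_eq_ofReal_abs, ENNReal.ofReal_rpow_of_nonneg (abs_nonneg _) hα.le]

end AlphaNorm

/-! ### Existence and characteristic function of the stochastic integral -/

section StochasticIntegral

variable {S Ω : Type*} [MeasurableSpace S] [MeasurableSpace Ω] {α : ℝ} {κ : Measure S}
  {P : Measure Ω} {Z : Set S → Ω → ℝ}

namespace IsStableRandomMeasure

lemma integral_exp_simpleStochasticIntegral (hZ : IsStableRandomMeasure α κ P Z) (hα : 0 < α)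
    {s : SimpleFunc S ℝ} (hs : s.FinMeasSupp κ) :
    ∫ ω, Complex.exp (Complex.I * (simpleStochasticIntegral Z s ω : ℂ)) ∂P
      = Complex.exp (((-(∫⁻ z, ‖s z‖ₑ ^ α ∂κ).toReal : ℝ) : ℂ)) := by
  have h := hZ.charFun_simpleStochasticIntegral hα hs 1
  rw [charFun_apply_real, integral_map
    (hZ.measurable_simpleStochasticIntegral hs).aemeasurable (by fun_prop)] at h
  simpa [mul_comm] using h

variable [IsProbabilityMeasure P]

/-- The characteristic function of a stochastic integral with respect to a symmetric stable
random measure. -/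
lemma integral_exp_of_isStochasticIntegral (hZ : IsStableRandomMeasure α κ P Z) (hα : 0 < α)
    {F : S → ℝ} (hF : AEMeasurable F κ) (hFκ : ∫⁻ z, ‖F z‖ₑ ^ α ∂κ ≠ ∞) {G : Ω → ℝ}
    (hG : IsStochasticIntegral α κ P Z F G) :
    ∫ ω, Complex.exp (Complex.I * (G ω : ℂ)) ∂P
      = Complex.exp (((-(∫⁻ z, ‖F z‖ₑ ^ α ∂κ).toReal : ℝ) : ℂ)) := by
  obtain ⟨s, hs, hsF, hsG⟩ := hG
  simp_rw [ofReal_abs_rpow hα] at hsF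
  have hlim := tendsto_lintegral_enorm_rpow hα hF hFκ
    (fun k => (s k).measurable.aemeasurable) hsF
  -- An almost surely convergent subsequence suffices, since the limit of the explicit
  -- characteristic functions is the same along it.
  obtain ⟨ns, hns, hae⟩ := hsG.exists_seq_tendsto_ae
  have h1 : Tendsto (fun k => ∫ ω, Complex.exp (Complex.I *
      (simpleStochasticIntegral Z (s (ns k)) ω : ℂ)) ∂P) atTop
      (𝓝 (∫ ω, Complex.exp (Complex.I * (G ω : ℂ)) ∂P)) := by
    refine tendsto_integral_of_dominated_convergence (fun _ => 1) (fun k => ?_)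
      (integrable_const _) (fun k => ae_of_all _ fun ω => ?_) ?_
    · have := hZ.measurable_simpleStochasticIntegral (hs (ns k))
      exact Measurable.aestronglyMeasurable (by fun_prop)
    · rw [mul_comm, Complex.norm_exp_ofReal_mul_I]
    · filter_upwards [hae] with ω hω
      have hc : Continuous fun x : ℝ => Complex.exp (Complex.I * (x : ℂ)) := by fun_prop
      exact (hc.tendsto _).comp hω
  refine tendsto_nhds_unique h1 ?_
  simp_rw [fun k => hZ.integral_exp_simpleStochasticIntegral hα (hs (ns k))]
  have hc : Continuous fun x : ℝ => Complex.exp (((-x : ℝ) : ℂ)) := by fun_prop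
  exact (hc.tendsto _).comp
    ((ENNReal.tendsto_toReal hFκ).comp (hlim.comp hns.tendsto_atTop))

/-- The tail is bounded by the mean of `1 - φ` near the origin, with `φ` the characteristic
function. This replaces Chebyshev, as stable variables with `α < 2` have infinite variance. -/
lemma measureReal_abs_simpleStochasticIntegral_gt_le (hZ : IsStableRandomMeasure α κ P Z)
    (hα : 0 < α) {s : SimpleFunc S ℝ} (hs : s.FinMeasSupp κ) {r : ℝ} (hr : 0 < r) :
    P.real {ω | r < |simpleStochasticIntegral Z s ω|}
      ≤ 2 * ((2 / r) ^ α * (∫⁻ z, ‖s z‖ₑ ^ α ∂κ).toReal) := by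
  have hm := hZ.measurable_simpleStochasticIntegral hs
  have := Measure.isProbabilityMeasure_map (μ := P) hm.aemeasurable
  have h := measureReal_abs_gt_le_integral_charFun
    (μ := P.map (simpleStochasticIntegral Z s)) hr
  rw [map_measureReal_apply hm (measurableSet_lt measurable_const (by fun_prop))] at h
  refine h.trans ?_
  set v := (∫⁻ z, ‖s z‖ₑ ^ α ∂κ).toReal with hv
  have hv0 : 0 ≤ v := ENNReal.toReal_nonneg
  have hb : ∀ t ∈ Set.uIoc (-2 * r⁻¹) (2 * r⁻¹),
      ‖1 - charFun (P.map (simpleStochasticIntegral Z s)) t‖ ≤ (2 / r) ^ α * v := by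
    intro t ht
    have hr' : 0 < r⁻¹ := inv_pos.2 hr
    rw [Set.uIoc_of_le (by linarith)] at ht
    have ht' : |t| ≤ 2 / r := by
      rw [abs_le, div_eq_mul_inv]
      constructor <;> linarith [ht.1, ht.2]
    have hx : 0 ≤ |t| ^ α * v := by positivity
    rw [hZ.charFun_simpleStochasticIntegral hα hs, ← Complex.ofReal_exp, ← Complex.ofReal_one,
      ← Complex.ofReal_sub, Complex.norm_real, Real.norm_eq_abs, abs_of_nonneg
      (sub_nonneg.2 (Real.exp_le_one_iff.2 (by linarith)))]
    have h1 := Real.add_one_le_exp (-(|t| ^ α * v))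
    have h2 : |t| ^ α * v ≤ (2 / r) ^ α * v := by gcongr
    linarith
  have h3 := intervalIntegral.norm_integral_le_of_norm_le_const hb
  have h4 : |2 * r⁻¹ - -2 * r⁻¹| = 4 * r⁻¹ := by
    rw [abs_of_nonneg] <;> [ring; skip]
    have : 0 < r⁻¹ := inv_pos.2 hr
    linarith
  rw [h4] at h3
  calc 2⁻¹ * r * _ ≤ 2⁻¹ * r * ((2 / r) ^ α * v * (4 * r⁻¹)) := by gcongr
    _ = 2 * ((2 / r) ^ α * v) := by field_simp; ring

lemma exists_isStochasticIntegral (hZ : IsStableRandomMeasure α κ P Z) (hα : 0 < α)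
    (hα2 : α ≤ 2) {F : S → ℝ} (hF : AEMeasurable F κ) (hFκ : ∫⁻ z, ‖F z‖ₑ ^ α ∂κ < ∞) :
    ∃ G : Ω → ℝ, IsStochasticIntegral α κ P Z F G := by
  -- Successive differences then have size at most `8^{-(k+1)}`. Since `α ≤ 2`, the tail at level
  -- `2^{-k}` is at most `2 · 4^{k+1} · 8^{-(k+1)} = 2^{-k}`, which is summable.
  let c : ℕ → ℝ := fun k => (1 / 8) ^ (k + 1) / 2
  have hc : ∀ k, 0 < c k := fun k => by positivity
  have hcanti : ∀ k, c (k + 1) ≤ c k := fun k => by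
    simp only [c]
    gcongr ?_ / 2
    exact pow_le_pow_of_le_one (by norm_num) (by norm_num) (by omega)
  choose s hs hsF using fun k => exists_simpleFunc_alphaNorm_sub_lt hα hF hFκ
    (ENNReal.ofReal_pos.2 (hc k)).ne'
  have hp1 : 1 ≤ max α 1 := le_max_right _ _
  have hp : 0 < max α 1 := one_pos.trans_le hp1
  have hsub : ∀ k, (s (k + 1) - s k).FinMeasSupp κ := fun k => by
    have : s (k + 1) - s k = ((s (k + 1)).pair (s k)).map fun c => c.1 - c.2 := by ext; simp
    rw [this]
    exact ((hs (k + 1)).pair (hs k)).map (by simp)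
  have hv : ∀ k, (∫⁻ z, ‖(s (k + 1) - s k) z‖ₑ ^ α ∂κ).toReal ≤ (1 / 8) ^ (k + 1) := by
    intro k
    have h1 : alphaNorm α κ (s (k + 1) - s k) ≤ ENNReal.ofReal ((1 / 8) ^ (k + 1)) := by
      have h2 := alphaNorm_add_le hα (hF.sub (s k).measurable.aemeasurable)
        ((s (k + 1)).measurable.aemeasurable.sub hF)
      rw [sub_add_sub_cancel', alphaNorm_sub_comm (s (k + 1)) F] at h2
      refine h2.trans ((add_le_add (hsF k).le (hsF (k + 1)).le).trans ?_)
      rw [← ENNReal.ofReal_add (hc _).le (hc _).le]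
      refine ENNReal.ofReal_le_ofReal ?_
      have h3 := hcanti k
      have h4 : c k + c k = (1 / 8) ^ (k + 1) := by simp only [c]; ring
      linarith
    have h5 : (∫⁻ z, ‖(s (k + 1) - s k) z‖ₑ ^ α ∂κ) ≤ ENNReal.ofReal ((1 / 8) ^ (k + 1)) := by
      have h6 := ENNReal.rpow_le_rpow h1 hp.le
      rw [alphaNorm_rpow] at h6
      refine h6.trans ((ENNReal.rpow_le_rpow_of_exponent_ge ?_ hp1).trans
        (ENNReal.rpow_one _).le)
      rw [ENNReal.ofReal_le_one]
      exact pow_le_one₀ (by norm_num) (by norm_num)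
    exact ENNReal.toReal_le_of_le_ofReal (by positivity) h5
  have hP : ∀ k : ℕ, P.real {ω | (1 / 2 : ℝ) ^ k < |simpleStochasticIntegral Z (s (k + 1) - s k) ω|}
      ≤ (1 / 2) ^ k := by
    intro k
    refine (hZ.measureReal_abs_simpleStochasticIntegral_gt_le hα (hsub k)
      (by positivity : (0 : ℝ) < (1 / 2) ^ k)).trans ?_
    have h1 : (2 / (1 / 2 : ℝ) ^ k) = 2 ^ (k + 1) := by
      rw [one_div, inv_pow, div_inv_eq_mul, pow_succ']
    have h2 : ((2 : ℝ) ^ (k + 1)) ^ α ≤ 4 ^ (k + 1) := by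
      refine (Real.rpow_le_rpow_of_exponent_le (one_le_pow₀ one_le_two) hα2).trans (le_of_eq ?_)
      rw [Real.rpow_two, ← pow_mul, mul_comm, pow_mul]
      norm_num
    rw [h1]
    calc _ ≤ 2 * ((4 : ℝ) ^ (k + 1) * (1 / 8) ^ (k + 1)) := by
          gcongr
          exact hv k
      _ = (1 / 2) ^ k := by
          rw [← mul_pow, show (4 * (1 / 8) : ℝ) = 1 / 2 by norm_num, pow_succ]
          ring
  have hsum : ∑' k, P {ω | (1 / 2 : ℝ) ^ k < |simpleStochasticIntegral Z (s (k + 1) - s k) ω|}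
      ≠ ∞ := by
    have h1 : Summable fun k : ℕ => (1 / 2 : ℝ) ^ k :=
      summable_geometric_of_lt_one (by norm_num) (by norm_num)
    refine ne_top_of_le_ne_top h1.tsum_ofReal_ne_top (ENNReal.tsum_le_tsum fun k => ?_)
    rw [← ofReal_measureReal]
    exact ENNReal.ofReal_le_ofReal (hP k)
  have hsubae := ae_all_iff.2 fun k => hZ.ae_simpleStochasticIntegral_sub (hs (k + 1)) (hs k)
  -- By Borel–Cantelli the increments are eventually at most `2^{-k}`.
  have hcau : ∀ᵐ ω ∂P, CauchySeq fun k => simpleStochasticIntegral Z (s k) ω := by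
    filter_upwards [ae_eventually_notMem hsum, hsubae] with ω h1 h2
    refine cauchySeq_of_summable_dist (Summable.of_norm_bounded_eventually_nat
      (summable_geometric_of_lt_one (by norm_num) (by norm_num : (1 / 2 : ℝ) < 1)) ?_)
    filter_upwards [h1] with k hk
    have hk' : |simpleStochasticIntegral Z (s (k + 1) - s k) ω| ≤ (1 / 2 : ℝ) ^ k :=
      not_lt.1 hk
    rwa [h2 k, ← Real.dist_eq, dist_comm, ← Real.norm_of_nonneg dist_nonneg] at hk'
  refine ⟨fun ω => limUnder atTop fun k => simpleStochasticIntegral Z (s k) ω, s, hs, ?_, ?_⟩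
  · simp_rw [ofReal_abs_rpow hα]
    have h1 : Tendsto (fun k => alphaNorm α κ (F - s k)) atTop (𝓝 0) := by
      refine tendsto_of_tendsto_of_tendsto_of_le_of_le tendsto_const_nhds ?_
        (fun _ => zero_le) fun k => (hsF k).le
      rw [← ENNReal.ofReal_zero]
      refine ENNReal.tendsto_ofReal ?_
      have h2 : Tendsto (fun k : ℕ => (1 / 8 : ℝ) ^ k) atTop (𝓝 0) :=
        tendsto_pow_atTop_nhds_zero_of_lt_one (by norm_num) (by norm_num)
      simpa [c] using ((tendsto_add_atTop_iff_nat 1).2 h2).div_const 2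
    have h3 := (ENNReal.continuous_rpow_const (y := max α 1)).tendsto 0 |>.comp h1
    rw [ENNReal.zero_rpow_of_pos hp] at h3
    refine h3.congr fun k => ?_
    exact alphaNorm_rpow _
  · refine tendstoInMeasure_of_tendsto_ae
      (fun k => (hZ.measurable_simpleStochasticIntegral (hs k)).aestronglyMeasurable) ?_
    filter_upwards [hcau] with ω hω
    exact hω.tendsto_limUnder

end IsStableRandomMeasure

end StochasticIntegral

/-! ### Limit of the one-layer deficit -/

section AggregatedLimit

/-- Here `a → 0`, and `(1 - a)^k` is squeezed between `exp(-k a / (1 - a))` and `exp(-k a)`. -/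
lemma tendsto_one_sub_pow_exp {a : ℕ → ℝ} {k : ℕ → ℕ} {L : ℝ}
    (hk : Tendsto k atTop atTop) (h : Tendsto (fun n => (k n : ℝ) * a n) atTop (𝓝 L)) :
    Tendsto (fun n => (1 - a n) ^ k n) atTop (𝓝 (Real.exp (-L))) := by
  have hkR : Tendsto (fun n => (k n : ℝ)) atTop atTop := tendsto_natCast_atTop_atTop.comp hk
  have ha0 : Tendsto a atTop (𝓝 0) := by
    refine (h.div_atTop hkR).congr' ?_
    filter_upwards [hk.eventually_ge_atTop 1] with n hn
    have : (k n : ℝ) ≠ 0 := by positivity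
    field_simp
  have hlow : Tendsto (fun n => Real.exp (-(k n * a n) / (1 - a n))) atTop
      (𝓝 (Real.exp (-L))) := by
    refine (Real.continuous_exp.tendsto _).comp ?_
    have h1 := h.neg.div (tendsto_const_nhds.sub ha0) (by norm_num : (1 : ℝ) - 0 ≠ 0)
    rw [sub_zero, div_one] at h1
    exact h1
  have hup : Tendsto (fun n => Real.exp (-(k n * a n))) atTop (𝓝 (Real.exp (-L))) :=
    (Real.continuous_exp.tendsto _).comp h.neg
  have hlt : ∀ᶠ n in atTop, a n < 1 := ha0.eventually_lt_const one_pos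
  refine tendsto_of_tendsto_of_tendsto_of_le_of_le' hlow hup ?_ ?_
  · filter_upwards [hlt] with n hn
    have h1 : 0 < 1 - a n := by linarith
    have h2 : Real.exp (-(a n / (1 - a n))) ≤ 1 - a n := by
      rw [Real.exp_neg, inv_le_comm₀ (Real.exp_pos _) h1]
      refine le_trans (le_of_eq ?_) (Real.add_one_le_exp _)
      field_simp
      ring
    calc _ = Real.exp (-(a n / (1 - a n))) ^ k n := by
          rw [← Real.exp_nat_mul]; congr 1; ring
      _ ≤ _ := pow_le_pow_left₀ (Real.exp_pos _).le h2 _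
  · filter_upwards [hlt] with n hn
    calc (1 - a n) ^ k n ≤ Real.exp (-a n) ^ k n :=
          pow_le_pow_left₀ (by linarith) (Real.one_sub_le_exp_neg _) _
      _ = _ := by rw [← Real.exp_nat_mul]; congr 1; ring

lemma integral_exp_mul_of_indepFun {Ω V : Type*} [MeasurableSpace Ω] [MeasurableSpace V]
    {P : Measure Ω} [IsProbabilityMeasure P] {X : Ω → ℝ} {Y : Ω → V} (hX : Measurable X)
    (hY : Measurable Y) (hXY : IndepFun X Y P) {w : V → ℝ} (hw : Measurable w) :
    ∫ ω, Complex.exp (((X ω * w (Y ω) : ℝ) : ℂ) * Complex.I) ∂P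
      = ∫ v, charFun (P.map X) (w v) ∂(P.map Y) := by
  have := Measure.isProbabilityMeasure_map (μ := P) hX.aemeasurable
  have := Measure.isProbabilityMeasure_map (μ := P) hY.aemeasurable
  have hg : Measurable fun p : ℝ × V => Complex.exp (((p.1 * w p.2 : ℝ) : ℂ) * Complex.I) := by
    fun_prop
  have hint : Integrable (fun p : ℝ × V => Complex.exp (((p.1 * w p.2 : ℝ) : ℂ) * Complex.I))
      ((P.map X).prod (P.map Y)) :=
    Integrable.of_bound hg.aestronglyMeasurable 1
      (ae_of_all _ fun p => (Complex.norm_exp_ofReal_mul_I _).le)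
  rw [← integral_map (φ := fun ω => (X ω, Y ω)) (hX.prodMk hY).aemeasurable
    hg.aestronglyMeasurable, hXY.map_prod_eq_prod_map_map hX.aemeasurable hY.aemeasurable,
    integral_prod_symm _ hint]
  refine integral_congr_ae (ae_of_all _ fun v => ?_)
  simp only
  rw [charFun_apply_real]
  refine integral_congr_ae (ae_of_all _ fun x => ?_)
  simp only
  push_cast
  ring_nf

variable {E : Type*} [MeasurableSpace E] {Q : Kernel ℝ (PointMeasure E)} [IsMarkovKernel Q]

/-- The substitution `r = n q`, with Jacobian `1/n`, moves the `n`-dependence of the law of `(q, N)`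
into the cutoff `r < n`. -/
lemma lintegral_comp_mul_Ioo_compProd {n : ℝ} (hn : 0 < n) {H : ℝ × PointMeasure E → ℝ≥0∞}
    (hH : Measurable H) :
    ∫⁻ p, H (n * p.1, p.2) ∂((volume.restrict (Set.Ioo (0 : ℝ) 1)) ⊗ₘ
        (Q.comap (fun r : ℝ => n * r) (measurable_const_mul n)))
      = ENNReal.ofReal n⁻¹ * ∫⁻ z, {z : ℝ × PointMeasure E | z.1 < n}.indicator H z
          ∂((volume.restrict (Set.Ioi (0 : ℝ))) ⊗ₘ Q) := by
  have hset : MeasurableSet {z : ℝ × PointMeasure E | z.1 < n} :=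
    measurableSet_lt measurable_fst measurable_const
  have hK : Measurable fun r => ∫⁻ m, H (r, m) ∂(Q r) := hH.lintegral_kernel_prod_right'
  rw [Measure.lintegral_compProd (by fun_prop), Measure.lintegral_compProd (hH.indicator hset),
    ← lintegral_indicator measurableSet_Ioo, ← lintegral_indicator measurableSet_Ioi]
  have e1 : ∀ q, (Set.Ioo (0 : ℝ) 1).indicator (fun q => ∫⁻ m, H (n * (q, m).1, (q, m).2)
      ∂(Q.comap (fun r : ℝ => n * r) (measurable_const_mul n) q)) q
      = (Set.Ioo 0 n).indicator (fun r => ∫⁻ m, H (r, m) ∂(Q r)) (n * q) := by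
    intro q
    have hiff : n * q ∈ Set.Ioo 0 n ↔ q ∈ Set.Ioo (0 : ℝ) 1 := by
      simp only [Set.mem_Ioo, mul_pos_iff_of_pos_left hn, mul_lt_iff_lt_one_right hn]
    by_cases hq : q ∈ Set.Ioo (0 : ℝ) 1
    · rw [Set.indicator_of_mem hq, Set.indicator_of_mem (hiff.2 hq), Kernel.comap_apply]
    · rw [Set.indicator_of_notMem hq, Set.indicator_of_notMem (mt hiff.1 hq)]
  have e2 : ∀ r, (Set.Ioi (0 : ℝ)).indicator (fun r => ∫⁻ m,
      {z : ℝ × PointMeasure E | z.1 < n}.indicator H (r, m) ∂(Q r)) r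
      = (Set.Ioo 0 n).indicator (fun r => ∫⁻ m, H (r, m) ∂(Q r)) r := by
    intro r
    by_cases h0 : 0 < r <;> by_cases h1 : r < n <;> simp [Set.indicator, h0, h1]
  simp_rw [e1, e2]
  have hind := hK.indicator (measurableSet_Ioo (a := (0 : ℝ)) (b := n))
  rw [← lintegral_map hind (measurable_const_mul n), Real.map_volume_mul_left hn.ne',
    lintegral_smul_measure, abs_of_pos (inv_pos.2 hn), smul_eq_mul]

variable {α : ℝ} {Ψ : ℝ × PointMeasure E → ℝ}

lemma lintegral_two_div_mul_rpow (hΨ : Measurable Ψ) (hα : 0 < α) :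
    ∫⁻ z, ENNReal.ofReal (2 / z.1 * |Ψ z| ^ α) ∂((volume.restrict (Set.Ioi (0 : ℝ))) ⊗ₘ Q)
      = ∫⁻ z, ‖Ψ z‖ₑ ^ α ∂(controlMeasure Q) := by
  rw [lintegral_controlMeasure (by fun_prop), Measure.lintegral_compProd (by fun_prop)]
  refine setLIntegral_congr_fun measurableSet_Ioi fun r hr => ?_
  have h2 : 0 ≤ 2 / r := div_nonneg zero_le_two (le_of_lt hr)
  simp only
  rw [← lintegral_const_mul' _ _ ENNReal.ofReal_ne_top]
  refine lintegral_congr fun m => ?_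
  rw [ENNReal.ofReal_mul h2, ofReal_abs_rpow hα]

lemma one_sub_exp_neg_mul_div_le {t b : ℝ} (ht : 0 ≤ t) (hb : 0 ≤ b) :
    (1 - Real.exp (-(t * b))) / t ≤ b := by
  -- At `t = 0` the quotient is `0` by the convention for division.
  rcases ht.eq_or_lt with rfl | ht
  · simpa using hb
  · rw [div_le_iff₀ ht]
    have := Real.add_one_le_exp (-(t * b))
    linarith

/-- The quotient is a difference quotient at `0` of `s ↦ 1 - exp(-s b)`, whose derivative there is
`b`. -/
lemma tendsto_one_sub_exp_neg_mul_div {t : ℕ → ℝ} (ht : ∀ᶠ n in atTop, 0 < t n)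
    (ht0 : Tendsto t atTop (𝓝 0)) (b : ℝ) :
    Tendsto (fun n => (1 - Real.exp (-(t n * b))) / t n) atTop (𝓝 b) := by
  have hd : HasDerivAt (fun s : ℝ => 1 - Real.exp (-(s * b))) b 0 := by
    have h1 : HasDerivAt (fun s : ℝ => -(s * b)) (-b) 0 :=
      (hasDerivAt_mul_const b).neg
    simpa using h1.exp.const_sub 1
  have h2 := hd.tendsto_slope
  have h3 : Tendsto t atTop (𝓝[≠] 0) :=
    tendsto_nhdsWithin_iff.2 ⟨ht0, ht.mono fun n hn => hn.ne'⟩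
  refine (h2.comp h3).congr fun n => ?_
  simp [slope_def_field]

/-- The deficit of the characteristic function of one layer, multiplied by the number of layers,
converges to the exponent of the limit. -/
lemma tendsto_lintegral_one_sub_exp (hΨ : Measurable Ψ) (hα : 0 < α)
    (hΨκ : ∫⁻ z, ‖Ψ z‖ₑ ^ α ∂(controlMeasure Q) ≠ ∞) {t : ℕ → ℝ} (ht : ∀ n, 0 ≤ t n)
    (htpos : ∀ᶠ n in atTop, 0 < t n) (ht0 : Tendsto t atTop (𝓝 0)) :
    Tendsto (fun n : ℕ => ∫⁻ z, {z : ℝ × PointMeasure E | z.1 < n}.indicator (fun z =>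
        ENNReal.ofReal ((1 - Real.exp (-(t n * (2 / z.1 * |Ψ z| ^ α)))) / t n)) z
        ∂((volume.restrict (Set.Ioi (0 : ℝ))) ⊗ₘ Q)) atTop
      (𝓝 (∫⁻ z, ‖Ψ z‖ₑ ^ α ∂(controlMeasure Q))) := by
  rw [← lintegral_two_div_mul_rpow hΨ hα] at hΨκ ⊢
  have hpos : ∀ᵐ z ∂((volume.restrict (Set.Ioi (0 : ℝ))) ⊗ₘ Q), 0 < z.1 := by
    rw [Measure.ae_compProd_iff (measurableSet_lt measurable_const measurable_fst)]
    filter_upwards [ae_restrict_mem measurableSet_Ioi] with r hr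
    exact ae_of_all _ fun _ => hr
  -- The pointwise limit is itself the dominating function; the cutoff `z.1 < n` holds eventually.
  refine tendsto_lintegral_of_dominated_convergence
    (fun z => ENNReal.ofReal (2 / z.1 * |Ψ z| ^ α)) (fun n => ?_) (fun n => ?_) hΨκ ?_
  · exact Measurable.indicator (by fun_prop) (measurableSet_lt measurable_fst measurable_const)
  · filter_upwards [hpos] with z hz
    refine (Set.indicator_le_self _ _ z).trans (ENNReal.ofReal_le_ofReal ?_)
    exact one_sub_exp_neg_mul_div_le (ht n) (by positivity)
  · refine ae_of_all _ fun z => ?_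
    refine (ENNReal.tendsto_ofReal
      (tendsto_one_sub_exp_neg_mul_div htpos ht0 (2 / z.1 * |Ψ z| ^ α))).congr' ?_
    filter_upwards [tendsto_natCast_atTop_atTop.eventually_gt_atTop z.1] with n hn
    rw [Set.indicator_of_mem]
    exact hn

end AggregatedLimit

/-! ### Characteristic function of the aggregated sum -/

section AggregatedModel

variable {E Ω : Type*} [MeasurableSpace E] [MeasurableSpace Ω] {α : ℝ}
  {Q : Kernel ℝ (PointMeasure E)} [IsMarkovKernel Q] {P : Measure Ω} {X q : ℕ → Ω → ℝ}
  {N : ℕ → ℕ → Ω → PointMeasure E}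

/-- The coefficient of `X i` in the aggregated sum, as a function of `(q i, N n i)`. -/
def layerWeight (α : ℝ) (Ψ : ℝ × PointMeasure E → ℝ) (k n : ℕ) (v : ℝ × PointMeasure E) : ℝ :=
  (2 / (k : ℝ)) ^ (1 / α) * (Ψ ((n : ℝ) * v.1, v.2) / v.1 ^ (1 / α))

lemma measurable_layerWeight {Ψ : ℝ × PointMeasure E → ℝ} (hΨ : Measurable Ψ) (k n : ℕ) :
    Measurable (layerWeight α Ψ k n) := by
  unfold layerWeight
  fun_prop

/-- Writing `1/q = n / (n q)` expresses the weight through `r = n q`, up to the small factor `n / k`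
that drives the limit. -/
lemma abs_layerWeight_rpow (hα : 0 < α) (Ψ : ℝ × PointMeasure E → ℝ) {k n : ℕ} (hn : 0 < n)
    {v : ℝ × PointMeasure E} (hv : 0 < v.1) :
    |layerWeight α Ψ k n v| ^ α
      = (n / k : ℝ) * (2 / (n * v.1) * |Ψ ((n : ℝ) * v.1, v.2)| ^ α) := by
  have h1 : 0 < v.1 ^ (1 / α) := Real.rpow_pos_of_pos hv _
  have h2 : (0 : ℝ) ≤ 2 / k := by positivity
  have hn' : (0 : ℝ) < n := Nat.cast_pos.2 hn
  have hpow : ∀ {x : ℝ}, 0 ≤ x → (x ^ (1 / α)) ^ α = x := fun hx => by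
    rw [← Real.rpow_mul hx, one_div, inv_mul_cancel₀ hα.ne', Real.rpow_one]
  rw [layerWeight, abs_mul, abs_div, abs_of_pos h1, abs_of_nonneg (Real.rpow_nonneg h2 _),
    Real.mul_rpow (Real.rpow_nonneg h2 _) (by positivity), Real.div_rpow (abs_nonneg _) h1.le,
    hpow h2, hpow hv.le]
  field_simp

namespace IsAggregatedModel

lemma ae_pos_mem (h : IsAggregatedModel α Q P X q N) {T : Set (PointMeasure E)}
    (hT : MeasurableSet T) (hQT : ∀ r : ℝ, 0 < r → ∀ᵐ m ∂(Q r), m ∈ T) {n : ℕ} (hn : 1 ≤ n)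
    (i : ℕ) : ∀ᵐ ω ∂P, 0 < q i ω ∧ N n i ω ∈ T := by
  have hn' : (0 : ℝ) < n := Nat.cast_pos.2 hn
  have hm : MeasurableSet {z : ℝ × PointMeasure E | 0 < z.1 ∧ z.2 ∈ T} :=
    (measurableSet_lt measurable_const measurable_fst).inter (hT.preimage measurable_snd)
  have h1 : ∀ᵐ v ∂(P.map fun ω => (q i ω, N n i ω)), 0 < v.1 ∧ v.2 ∈ T := by
    rw [h.map_q_N n hn i, Measure.ae_compProd_iff hm]
    filter_upwards [ae_restrict_mem measurableSet_Ioo] with r hr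
    rw [Kernel.comap_apply]
    filter_upwards [hQT (n * r) (mul_pos hn' hr.1)] with m hm
    exact ⟨hr.1, hm⟩
  exact ae_of_ae_map ((h.measurable_q i).prodMk (h.measurable_N n hn i)).aemeasurable h1

lemma aggregatedSum_ae_eq {M : Type*} [MeasurableSpace M] (h : IsAggregatedModel α Q P X q N)
    {A : M → Set E} {lam : Measure M} {f : M → ℝ} {Ψ : ℝ × PointMeasure E → ℝ}
    {T : Set (PointMeasure E)}
    (hT : MeasurableSet T) (hQT : ∀ r : ℝ, 0 < r → ∀ᵐ m ∂(Q r), m ∈ T)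
    (hΨT : ∀ r : ℝ, 0 < r → ∀ m ∈ T, Ψ (r, m) = oddFunctional Q A lam f (r, m))
    {n : ℕ} (hn : 1 ≤ n) (k : ℕ) :
    aggregatedSum α Q A lam X q N k n f =ᵐ[P]
      fun ω => ∑ i ∈ Finset.range k, X i ω * layerWeight α Ψ k n (q i ω, N n i ω) := by
  have hn' : (0 : ℝ) < n := Nat.cast_pos.2 hn
  filter_upwards [ae_all_iff.2 fun i => h.ae_pos_mem hT hQT hn i] with ω hω
  rw [aggregatedSum, Finset.mul_sum]
  refine Finset.sum_congr rfl fun i _ => ?_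
  rw [layerWeight, hΨT _ (mul_pos hn' (hω i).1) _ (hω i).2]
  ring

variable [IsProbabilityMeasure P]

lemma charFun_layer (h : IsAggregatedModel α Q P X q N) (hα : 0 < α)
    {Ψ : ℝ × PointMeasure E → ℝ} (hΨ : Measurable Ψ) {k n : ℕ} (hn : 1 ≤ n) (i : ℕ) :
    charFun (P.map fun ω => X i ω * layerWeight α Ψ k n (q i ω, N n i ω)) 1
      = ((1 - (ENNReal.ofReal (n : ℝ)⁻¹ *
        ∫⁻ z, {z : ℝ × PointMeasure E | z.1 < n}.indicator (fun z =>
          ENNReal.ofReal (1 - Real.exp (-((n / k : ℝ) * (2 / z.1 * |Ψ z| ^ α))))) z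
          ∂((volume.restrict (Set.Ioi (0 : ℝ))) ⊗ₘ Q)).toReal : ℝ) : ℂ) := by
  have hn' : (0 : ℝ) < n := Nat.cast_pos.2 hn
  have hw := measurable_layerWeight (α := α) hΨ k n
  have hqN : Measurable fun ω => (q i ω, N n i ω) :=
    (h.measurable_q i).prodMk (h.measurable_N n hn i)
  have hpm := Measure.isProbabilityMeasure_map (μ := P) hqN.aemeasurable
  have hm : Measurable fun ω => X i ω * layerWeight α Ψ k n (q i ω, N n i ω) :=
    (h.measurable_X i).mul (hw.comp hqN)
  rw [charFun_apply_real, integral_map hm.aemeasurable (by fun_prop)]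
  simp only [Complex.ofReal_one, one_mul]
  rw [integral_exp_mul_of_indepFun (h.measurable_X i) hqN (h.indep_X n hn i) hw]
  simp_rw [h.charFun_X, ← Complex.ofReal_exp]
  rw [integral_complex_ofReal]
  congr 1
  have hpos : ∀ᵐ v ∂(P.map fun ω => (q i ω, N n i ω)), 0 < v.1 := by
    rw [ae_map_iff hqN.aemeasurable (measurableSet_lt measurable_const measurable_fst)]
    filter_upwards [h.ae_pos_mem MeasurableSet.univ (fun _ _ => by simp) hn i] with ω hω
    exact hω.1
  have hint : Integrable (fun v => Real.exp (-(|layerWeight α Ψ k n v| ^ α)))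
      (P.map fun ω => (q i ω, N n i ω)) := by
    refine Integrable.of_bound (Measurable.aestronglyMeasurable (by fun_prop)) 1
      (ae_of_all _ fun v => ?_)
    rw [Real.norm_eq_abs, Real.abs_exp, Real.exp_le_one_iff]
    have : 0 ≤ |layerWeight α Ψ k n v| ^ α := by positivity
    linarith
  -- The deficit is isolated because it is nonnegative, hence a `lintegral`, and because it is the
  -- quantity that the number of layers multiplies.
  have e1 : ∫ v, Real.exp (-(|layerWeight α Ψ k n v| ^ α)) ∂(P.map fun ω => (q i ω, N n i ω))
      = 1 - ∫ v, (1 - Real.exp (-(|layerWeight α Ψ k n v| ^ α)))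
        ∂(P.map fun ω => (q i ω, N n i ω)) := by
    rw [integral_sub (integrable_const _) hint]
    simp
  rw [e1, integral_eq_lintegral_of_nonneg_ae (ae_of_all _ fun v => ?_)
    (Measurable.aestronglyMeasurable (by fun_prop))]
  · congr 2
    rw [← lintegral_comp_mul_Ioo_compProd hn' (by fun_prop), ← h.map_q_N n hn i]
    refine lintegral_congr_ae ?_
    filter_upwards [hpos] with v hv
    rw [abs_layerWeight_rpow hα Ψ hn hv]
  · have : 0 ≤ |layerWeight α Ψ k n v| ^ α := by positivity
    simpa using this

lemma integral_exp_aggregatedSum {M : Type*} [MeasurableSpace M]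
    (h : IsAggregatedModel α Q P X q N) (hα : 0 < α)
    {A : M → Set E} {lam : Measure M} {f : M → ℝ} {Ψ : ℝ × PointMeasure E → ℝ} (hΨ : Measurable Ψ)
    {T : Set (PointMeasure E)}
    (hT : MeasurableSet T) (hQT : ∀ r : ℝ, 0 < r → ∀ᵐ m ∂(Q r), m ∈ T)
    (hΨT : ∀ r : ℝ, 0 < r → ∀ m ∈ T, Ψ (r, m) = oddFunctional Q A lam f (r, m))
    {n : ℕ} (hn : 1 ≤ n) (k : ℕ) :
    ∫ ω, Complex.exp (Complex.I * (aggregatedSum α Q A lam X q N k n f ω : ℂ)) ∂P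
      = (((1 - (ENNReal.ofReal (n : ℝ)⁻¹ *
        ∫⁻ z, {z : ℝ × PointMeasure E | z.1 < n}.indicator (fun z =>
          ENNReal.ofReal (1 - Real.exp (-((n / k : ℝ) * (2 / z.1 * |Ψ z| ^ α))))) z
          ∂((volume.restrict (Set.Ioi (0 : ℝ))) ⊗ₘ Q)).toReal) ^ k : ℝ) : ℂ) := by
  have hw := measurable_layerWeight (α := α) hΨ k n
  have hm : ∀ i, Measurable fun ω => X i ω * layerWeight α Ψ k n (q i ω, N n i ω) := fun i =>
    (h.measurable_X i).mul (hw.comp ((h.measurable_q i).prodMk (h.measurable_N n hn i)))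
  have hind : iIndepFun (fun i ω => X i ω * layerWeight α Ψ k n (q i ω, N n i ω)) P :=
    (h.iIndep n hn).comp (fun _ p => p.1 * layerWeight α Ψ k n p.2)
      (fun _ => measurable_fst.mul (hw.comp measurable_snd))
  have hsum := (hind.restrict (Finset.range k)).charFun_map_fun_finsetSum_eq_prod
    fun i _ => (hm i).aemeasurable
  have hsum1 := congrFun hsum 1
  rw [charFun_apply_real, integral_map
    (Finset.measurable_sum _ fun i _ => hm i).aemeasurable (by fun_prop)] at hsum1
  rw [Finset.prod_apply, Finset.prod_congr rfl fun i _ => h.charFun_layer hα hΨ hn i,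
    Finset.prod_const, Finset.card_range, ← Complex.ofReal_pow] at hsum1
  rw [← hsum1]
  refine integral_congr_ae ?_
  filter_upwards [h.aggregatedSum_ae_eq hT hQT hΨT hn k] with ω hω
  rw [hω, Complex.ofReal_one, one_mul, mul_comm]

end IsAggregatedModel

end AggregatedModel

end

/-! ### The main theorem -/

theorem theorem3p2
    {M E Ω Ω' : Type*} [MetricSpace M] [MeasurableSpace M] [BorelSpace M]
    [MeasurableSpace E] [MeasurableSpace Ω] [MeasurableSpace Ω']
    -- the measure definite metric
    (μ : Measure E) [SigmaFinite μ] (A : M → Set E) (hA : IsMeasureDefinite μ A)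
    (hAmeas : MeasurableSet {p : M × E | p.2 ∈ A p.1})
    (lam : Measure M)
    -- `Q r` is the law of the Poisson point process with intensity `r • μ`
    (Q : Kernel ℝ (PointMeasure E)) [IsMarkovKernel Q] (hQ : IsPoissonKernel μ Q)
    (α : ℝ) (hα0 : 0 < α) (hα2 : α ≤ 2)
    -- the aggregated model
    (P : Measure Ω) [IsProbabilityMeasure P] (X q : ℕ → Ω → ℝ) (N : ℕ → ℕ → Ω → PointMeasure E)
    (hmodel : IsAggregatedModel α Q P X q N)
    (m : ℕ → ℕ) (hm : Tendsto (fun n => (m n : ℝ) / (n : ℝ)) atTop atTop)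
    -- the stable random measure that defines the limit
    (P' : Measure Ω') [IsProbabilityMeasure P'] (Z : Set (ℝ × PointMeasure E) → Ω' → ℝ)
    (hZ : IsStableRandomMeasure α (controlMeasure Q) P' Z)
    (δ δ' : ℝ) (hδ : 0 < δ) (hδ' : 0 < δ')
    (f : M → ℝ) (hf : IsTestFunction μ A lam δ δ' 1 f) :
    (∃ G : Ω' → ℝ, IsStochasticIntegral α (controlMeasure Q) P' Z (oddFunctional Q A lam f) G) ∧
    ∀ G : Ω' → ℝ, IsStochasticIntegral α (controlMeasure Q) P' Z (oddFunctional Q A lam f) G →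
      Tendsto
        (fun n => ∫ ω, Complex.exp (Complex.I * (aggregatedSum α Q A lam X q N (m n) n f ω : ℂ)) ∂P)
        atTop (𝓝 (∫ ω', Complex.exp (Complex.I * (G ω' : ℂ)) ∂P')) := by
  obtain ⟨Ψ, hΨ, ⟨T, hT, hQT, hΨT⟩, C, C', hC, hC', hbound⟩ :=
    exists_measurable_oddFunctional hA hAmeas lam Q hQ hδ hf
  have hΨκ := lintegral_enorm_rpow_controlMeasure_lt_top hΨ hα0 hα2 (lt_min hδ one_pos) hδ'
    hC hC' hbound
  have hae : Ψ =ᵐ[controlMeasure Q] oddFunctional Q A lam f := by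
    filter_upwards [ae_controlMeasure_of_forall hT hQT] with z hz
    exact hΨT z.1 hz.1 z.2 hz.2
  have hF : AEMeasurable (oddFunctional Q A lam f) (controlMeasure Q) := ⟨Ψ, hΨ, hae.symm⟩
  have hFΨ : ∫⁻ z, ‖oddFunctional Q A lam f z‖ₑ ^ α ∂(controlMeasure Q)
      = ∫⁻ z, ‖Ψ z‖ₑ ^ α ∂(controlMeasure Q) := by
    refine lintegral_congr_ae ?_
    filter_upwards [hae] with z hz
    rw [hz]
  refine ⟨hZ.exists_isStochasticIntegral hα0 hα2 hF (hFΨ ▸ hΨκ), fun G hG => ?_⟩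
  rw [hZ.integral_exp_of_isStochasticIntegral hα0 hF (hFΨ ▸ hΨκ.ne) hG, hFΨ]
  -- For `n ≥ 1`, `m n / n ≤ m n`, so the growth condition forces `m n → ∞`.
  have hmtop : Tendsto m atTop atTop := by
    rw [← tendsto_natCast_atTop_iff (R := ℝ)]
    refine tendsto_atTop_mono' _ ?_ hm
    filter_upwards [eventually_ge_atTop 1] with n hn
    exact div_le_self (Nat.cast_nonneg _) (by exact_mod_cast hn)
  have ht0 : Tendsto (fun n : ℕ => (n / m n : ℝ)) atTop (𝓝 0) :=
    hm.inv_tendsto_atTop.congr fun n => inv_div _ _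
  have hpos : ∀ᶠ n : ℕ in atTop, (0 : ℝ) < n ∧ (0 : ℝ) < m n := by
    filter_upwards [eventually_ge_atTop 1, hmtop.eventually_ge_atTop 1] with n hn hmn
    exact ⟨Nat.cast_pos.2 hn, Nat.cast_pos.2 hmn⟩
  have hlim := (ENNReal.tendsto_toReal hΨκ.ne).comp (tendsto_lintegral_one_sub_exp hΨ hα0 hΨκ.ne
    (fun n : ℕ => by positivity) (hpos.mono fun n hn => div_pos hn.1 hn.2) ht0)
  have hpow := tendsto_one_sub_pow_exp
    (a := fun n : ℕ => (ENNReal.ofReal (n : ℝ)⁻¹ *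
        ∫⁻ z, {z : ℝ × PointMeasure E | z.1 < n}.indicator (fun z =>
          ENNReal.ofReal (1 - Real.exp (-((n / m n : ℝ) * (2 / z.1 * |Ψ z| ^ α))))) z
          ∂((volume.restrict (Set.Ioi (0 : ℝ))) ⊗ₘ Q)).toReal) hmtop (hlim.congr' ?_)
  · have hC := (Complex.continuous_ofReal.tendsto _).comp hpow
    rw [Complex.ofReal_exp] at hC
    refine hC.congr' ?_
    filter_upwards [eventually_ge_atTop 1] with n hn
    exact (hmodel.integral_exp_aggregatedSum hα0 hΨ hT hQT hΨT hn (m n)).symm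
  -- The prefactor `m n · n⁻¹` is `1 / t` for `t = n / m n`, which produces the quotient `(1 -
  -- exp(-t b)) / t`.
  · filter_upwards [hpos] with n hn
    have hmn : (0 : ℝ) ≤ m n := hn.2.le
    rw [Function.comp_apply, ← ENNReal.toReal_ofReal hmn, ← ENNReal.toReal_mul, ← mul_assoc,
      ← ENNReal.ofReal_mul hmn, ← lintegral_const_mul' _ _ ENNReal.ofReal_ne_top,
      ENNReal.toReal_ofReal hmn]
    congr 1
    refine lintegral_congr fun z => ?_
    by_cases hz : z ∈ {z : ℝ × PointMeasure E | z.1 < n}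
    · rw [Set.indicator_of_mem hz, Set.indicator_of_mem hz,
        ← ENNReal.ofReal_mul (mul_nonneg hmn (inv_nonneg.2 hn.1.le))]
      congr 1
      rw [div_div_eq_mul_div, div_eq_mul_inv, mul_comm (1 - _), mul_comm (m n : ℝ), mul_assoc]
      ring
    · rw [Set.indicator_of_notMem hz, Set.indicator_of_notMem hz, mul_zero]
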